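/- Let $d\ge 1$, let $\nu$ be a compactly supported Borel probability measure on $\mathbb{R}^d$ (with the Euclidean norm) and let $r>0$. Notation. $\mathcal D_n$ is the partition of $\mathbb{R}^d$ into the half-open cubes $\prod_{i=1}^d (k_i2^{-n},(k_i+1)2^{-n}]$, $k\in\mathbb{Z}^d$, and $\Lambda$ is Lebesgue measure. - Quantization error and dimensions: $\mathfrak e_{n,r}(\nu)=\inf_f\left(\int |x-f(x)|^r\,d\nu(x)\right)^{1/r}$, the infimum being over Borel maps $f:\mathbb{R}^d\to\mathbb{R}^d$ with at most $n$ values, and $\overline D_r(\nu)=\limsup_{n}\frac{\log n}{-\log \mathfrak e_{n,r}(\nu)}$, $\underline D_r(\nu)=\liminf_{n}\frac{\log n}{-\log \mathfrak e_{n,r}(\nu)}$ (the quotient is $0$ if $\mathfrak e_{n,r}(\nu)=0$). - $L^q$-spectrum: for $q\ge 0$, $\beta_{\nu,n}(q)=\frac{1}{\log 2^n}\log\sum_{C\in\mathcal D_n,\ \nu(C)>0}\nu(C)^q$, $\beta_\nu(q)=\limsup_n\beta_{\nu,n}(q)$, and $q_r=\inf\{q>0:\beta_\nu(q)<rq\}$.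 - Upper Rényi dimension: $\overline{\mathfrak R}_\nu(q)=\beta_\nu(q)/(1-q)$ for $q\ne 1$ and $\overline{\mathfrak R}_\nu(1)=\limsup_n \frac{\sum_{C\in\mathcal D_n}\nu(C)\log\nu(C)}{\log 2^{-n}}$ (with $0\log 0=0$). - Optimized coarse multifractal dimensions: with $\mathcal N_{\alpha}(n)=\mathrm{card}\{Q\in\mathcal D_n:\nu(Q)\Lambda(Q)^{r/d}\ge 2^{-\alpha n}\}$, put $\overline F_r=\sup_{\alpha>0}\frac1\alpha\limsup_n\frac{\log^+\mathcal N_\alpha(n)}{\log 2^n}$ and $\underline F_r=\sup_{\alpha>0}\frac1\alpha\liminf_n\frac{\log^+\mathcal N_\alpha(n)}{\log 2^n}$. - $\nu$ is $r$-MF-regular if $\underline F_r=\overline F_r$. - $\nu$ is $L^q$-regular for $r$ if (a) there is $\varepsilon>0$ with $\beta_\nu(q)=\liminf_n\beta_{\nu,n}(q)\in\mathbb{R}$ for all $q\in(q_r-\varepsilon,q_r)$, $q\ge0$, or (b) $\beta_\nu(q_r)=\liminf_n\beta_{\nu,n}(q_r)$ and $\beta_\nu:[0,\infty)\to\mathbb{R}$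 is differentiable at $q_r$. Theorem. 1. If $\nu$ is $L^q$-regular for $r$, then $\nu$ is $r$-MF-regular. 2. If $\nu$ is $r$-MF-regular, then the quantization dimension of order $r$ exists, i.e. $\underline D_r(\nu)=\overline D_r(\nu)$. The common value is $\overline{\mathfrak R}_\nu(q_r)$ if $q_r>0$, and it is $0$ if $q_r=0$. -/

import Mathlib

open MeasureTheory Filter Set Topology
open scoped ENNReal

noncomputable section

namespace QuantDim

/-- The half-open dyadic cube `∏ᵢ (kᵢ 2⁻ⁿ, (kᵢ + 1) 2⁻ⁿ]` of level `n` in `ℝᵈ`. For `d ≥ 1` the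
cubes of a fixed level are indexed injectively by `k ∈ ℤᵈ` and partition `ℝᵈ`; sums over, and
cardinalities of, families of cubes of level `n` are therefore taken over the index `k`. -/
def cube (d n : ℕ) (k : Fin d → ℤ) : Set (EuclideanSpace ℝ (Fin d)) :=
  {x | ∀ i, (k i : ℝ) * (2 : ℝ) ^ (-(n : ℤ)) < x i ∧
    x i ≤ ((k i : ℝ) + 1) * (2 : ℝ) ^ (-(n : ℤ))}

/-- `n`-quantizers: Borel maps `ℝᵈ → ℝᵈ` taking at most `n` values. -/
def quantizers (d n : ℕ) : Set (EuclideanSpace ℝ (Fin d) → EuclideanSpace ℝ (Fin d)) :=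
  {f | Measurable f ∧ (range f).encard ≤ n}

variable {d : ℕ}

/-- The `n`-th quantization error of order `r`. -/
def quantError (ν : Measure (EuclideanSpace ℝ (Fin d))) (r : ℝ) (n : ℕ) : ℝ≥0∞ :=
  ⨅ f ∈ quantizers d n, (∫⁻ x, ‖x - f x‖ₑ ^ r ∂ν) ^ (1 / r)

/-- Upper quantization dimension of order `r`. The logarithm is the extended one, `log 0 = -∞`,
so that the quotient is `0` as soon as the quantization error vanishes. -/
def upperQuantDim (ν : Measure (EuclideanSpace ℝ (Fin d))) (r : ℝ) : EReal :=
  limsup (fun n : ℕ => ((Real.log n : ℝ) : EReal) / (-ENNReal.log (quantError ν r n))) atTop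

/-- Lower quantization dimension of order `r`. -/
def lowerQuantDim (ν : Measure (EuclideanSpace ℝ (Fin d))) (r : ℝ) : EReal :=
  liminf (fun n : ℕ => ((Real.log n : ℝ) : EReal) / (-ENNReal.log (quantError ν r n))) atTop

open scoped Classical in
/-- `∑ ν(C)^q` over the cubes `C` of level `n`, cubes of measure zero being omitted
(the convention `0⁰ = 0`). -/
def partitionSum (ν : Measure (EuclideanSpace ℝ (Fin d))) (n : ℕ) (q : ℝ) : ℝ≥0∞ :=
  ∑' k : Fin d → ℤ, if ν (cube d n k) = 0 then 0 else ν (cube d n k) ^ q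

/-- The level-`n` exponent `β_{ν,n}(q)`. -/
def betaLevel (ν : Measure (EuclideanSpace ℝ (Fin d))) (n : ℕ) (q : ℝ) : EReal :=
  ENNReal.log (partitionSum ν n q) / ((Real.log (2 ^ n) : ℝ) : EReal)

/-- The `L^q`-spectrum `β_ν(q)`, of interest for `q ≥ 0`. -/
def beta (ν : Measure (EuclideanSpace ℝ (Fin d))) (q : ℝ) : EReal :=
  limsup (fun n : ℕ => betaLevel ν n q) atTop

/-- The lower limit `liminf_n β_{ν,n}(q)`. -/
def betaLower (ν : Measure (EuclideanSpace ℝ (Fin d))) (q : ℝ) : EReal :=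
  liminf (fun n : ℕ => betaLevel ν n q) atTop

/-- `q_r = inf {q > 0 : β_ν(q) < r q}`. -/
def critExp (ν : Measure (EuclideanSpace ℝ (Fin d))) (r : ℝ) : ℝ :=
  sInf {q : ℝ | 0 < q ∧ beta ν q < ((r * q : ℝ) : EReal)}

open scoped Classical in
/-- The upper generalized Rényi dimension. For compactly supported `ν` the sum in the case
`q = 1` has only finitely many nonzero terms. -/
def renyiDim (ν : Measure (EuclideanSpace ℝ (Fin d))) (q : ℝ) : EReal :=
  if q = 1 then
    limsup (fun n : ℕ =>
      (((∑' k : Fin d → ℤ, ν.real (cube d n k) * Real.log (ν.real (cube d n k))) /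
        Real.log ((2 : ℝ) ^ (-(n : ℤ))) : ℝ) : EReal)) atTop
  else beta ν q / ((1 - q : ℝ) : EReal)

/-- The number of cubes `Q` of level `n` with `ν(Q) Λ(Q)^{r/d} ≥ 2^{-αn}`. -/
def cubeCount (ν : Measure (EuclideanSpace ℝ (Fin d))) (r α : ℝ) (n : ℕ) : ℕ∞ :=
  {k : Fin d → ℤ | (2 : ℝ≥0∞) ^ (-(α * n)) ≤
    ν (cube d n k) * volume (cube d n k) ^ (r / d)}.encard

/-- `log⁺` of the cube count, divided by `log 2ⁿ`. -/
def coarseRatio (ν : Measure (EuclideanSpace ℝ (Fin d))) (r α : ℝ) (n : ℕ) : EReal :=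
  max 0 (ENNReal.log (cubeCount ν r α n : ℝ≥0∞)) / ((Real.log (2 ^ n) : ℝ) : EReal)

/-- The upper optimized coarse multifractal dimension. -/
def upperF (ν : Measure (EuclideanSpace ℝ (Fin d))) (r : ℝ) : EReal :=
  ⨆ (α : ℝ) (_ : 0 < α), limsup (fun n : ℕ => coarseRatio ν r α n) atTop / (α : EReal)

/-- The lower optimized coarse multifractal dimension. -/
def lowerF (ν : Measure (EuclideanSpace ℝ (Fin d))) (r : ℝ) : EReal :=
  ⨆ (α : ℝ) (_ : 0 < α), liminf (fun n : ℕ => coarseRatio ν r α n) atTop / (α : EReal)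

/-- Multifractal regularity in `r`. -/
def MFRegular (ν : Measure (EuclideanSpace ℝ (Fin d))) (r : ℝ) : Prop :=
  lowerF ν r = upperF ν r

/-- `L^q`-regularity for `r`. The spectrum is regarded as a function on its domain `[0, ∞)`:
only `q ≥ 0` are tested in the first alternative, and differentiability in the second one is
relative to `[0, ∞)` (which is ordinary differentiability if `q_r > 0`). -/
def LqRegular (ν : Measure (EuclideanSpace ℝ (Fin d))) (r : ℝ) : Prop :=
  (∃ ε : ℝ, 0 < ε ∧ ∀ q ∈ Ioo (critExp ν r - ε) (critExp ν r), 0 ≤ q →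
    beta ν q = betaLower ν q ∧ ∃ b : ℝ, beta ν q = (b : EReal)) ∨
  (beta ν (critExp ν r) = betaLower ν (critExp ν r) ∧
    ∃ g : ℝ → ℝ, (∀ q, 0 ≤ q → beta ν q = (g q : EReal)) ∧
      DifferentiableWithinAt ℝ g (Ici 0) (critExp ν r))

end QuantDim

end

/-! Write c for `critExp ν r` and J(Q) = ν(Q)Λ(Q)^{r/d}. The number c turns out to govern
everything, and c < 1. For every ν, the upper coarse dimension equals c. Markov's inequality applied
to the q-th moment of J, with q slightly above c, bounds the number of cubes with large J
(`upperF_le_critExp`). Conversely, if such cubes were rarer, cutting the moment into finitely many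
layers of J would keep it bounded at some q < c (`critExp_le_upperF`). Hence MF-regularity says
exactly that the lower coarse dimension is c as well. Under L^q-regularity this follows from a
large-deviation argument. Where β is differentiable at q with slope -a and agrees with its lower
limit, the q-th moment is carried by cubes of mass about 2^{-an}, so there are roughly
2^{(β(q)+aq)n} of them. Testing with α = r + a gives the quotient (β(q)+aq)/(r+a), which is at least
q when β(q) ≥ rq (`le_lowerF_of_differentiableAt`). In alternative (b) one takes q = c; in (a), β is
monotone, hence differentiable at points arbitrarily close below c. On the quantization side,
stopping at the first cube with J < t gives about t^{-q} cubes for any q with β(q) < rq, and one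
code point per cube yields the upper bound rc/(1-c) (`upperQuantDim_le_critExp`). For the lower
bound, M points come close to at most 3^d M cubes of a level, so half of a family of cubes with
large J still contributes to the error (`le_quantError_of_card`, `critExp_le_lowerQuantDim`).
Finally, β(c) = rc when c > 0 (`beta_critExp`), which identifies rc/(1-c) with the Rényi dimension.
-/

noncomputable section

namespace QuantDim

/-! ### Geometry of dyadic cubes and finite moment sums. -/

section

variable {d : ℕ}

/-- The index of the cube of level `n` that contains `x`. -/
def cubeIndex (n : ℕ) (x : EuclideanSpace ℝ (Fin d)) : Fin d → ℤ := fun i => ⌈x i * 2 ^ n⌉ - 1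

theorem mem_cube_iff {n : ℕ} {k : Fin d → ℤ} {x : EuclideanSpace ℝ (Fin d)} :
    x ∈ cube d n k ↔ cubeIndex n x = k := by
  have h2 : (0 : ℝ) < 2 ^ n := by positivity
  simp only [cube, mem_ofPred_eq, funext_iff, cubeIndex, zpow_neg, zpow_natCast]
  refine forall_congr' fun i => ?_
  rw [← div_eq_mul_inv, ← div_eq_mul_inv, div_lt_iff₀ h2, le_div_iff₀ h2, sub_eq_iff_eq_add,
    Int.ceil_eq_iff]
  push_cast
  rw [add_sub_cancel_right]

theorem mem_cube_cubeIndex (n : ℕ) (x : EuclideanSpace ℝ (Fin d)) :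
    x ∈ cube d n (cubeIndex n x) := mem_cube_iff.2 rfl

theorem measurable_cubeIndex (n : ℕ) :
    Measurable (cubeIndex n : EuclideanSpace ℝ (Fin d) → Fin d → ℤ) := by
  refine measurable_pi_lambda _ fun i => ?_
  have : Measurable fun x : EuclideanSpace ℝ (Fin d) => ⌈x i * 2 ^ n⌉ :=
    Int.measurable_ceil.comp (by fun_prop)
  exact this.sub_const 1

theorem cube_eq_preimage (n : ℕ) (k : Fin d → ℤ) : cube d n k = cubeIndex n ⁻¹' {k} := by
  ext x; exact mem_cube_iff

theorem measurableSet_cube (n : ℕ) (k : Fin d → ℤ) : MeasurableSet (cube d n k) := by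
  rw [cube_eq_preimage]
  exact measurable_cubeIndex n (measurableSet_singleton k)

theorem pairwise_disjoint_cube (n : ℕ) : Pairwise (Function.onFun Disjoint (cube d n)) := by
  intro k l hkl
  refine Set.disjoint_left.2 fun x hx hx' => hkl ?_
  rw [← mem_cube_iff.1 hx, mem_cube_iff.1 hx']

theorem iUnion_cube (n : ℕ) : ⋃ k, cube d n k = univ :=
  eq_univ_of_forall fun x => mem_iUnion.2 ⟨_, mem_cube_cubeIndex n x⟩

theorem volume_cube (n : ℕ) (k : Fin d → ℤ) :
    volume (cube d n k) = ENNReal.ofReal ((2 : ℝ) ^ (-(n : ℤ))) ^ d := by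
  have h := (EuclideanSpace.volume_preserving_symm_measurableEquiv_toLp (Fin d)).measure_preimage
    (s := Set.univ.pi fun i => Set.Ioc ((k i : ℝ) * (2 : ℝ) ^ (-(n : ℤ)))
      (((k i : ℝ) + 1) * (2 : ℝ) ^ (-(n : ℤ))))
    (MeasurableSet.univ_pi fun i => measurableSet_Ioc).nullMeasurableSet
  rw [Real.volume_pi_Ioc] at h
  have hc : cube d n k = (MeasurableEquiv.toLp 2 (Fin d → ℝ)).symm ⁻¹'
      (Set.univ.pi fun i => Set.Ioc ((k i : ℝ) * (2 : ℝ) ^ (-(n : ℤ)))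
      (((k i : ℝ) + 1) * (2 : ℝ) ^ (-(n : ℤ)))) := by
    ext x; simp [cube]
  rw [hc, h]
  have : ∀ i, ((k i : ℝ) + 1) * (2 : ℝ) ^ (-(n : ℤ)) - (k i : ℝ) * (2 : ℝ) ^ (-(n : ℤ)) =
      (2 : ℝ) ^ (-(n : ℤ)) := fun i => by ring
  simp only [this, Finset.prod_const, Finset.card_univ, Fintype.card_fin]

theorem volume_cube_rpow (hd : 0 < d) (n : ℕ) (k : Fin d → ℤ) {r : ℝ} (hr : 0 < r) :
    volume (cube d n k) ^ (r / d) = ENNReal.ofReal ((2 : ℝ) ^ (-(n * r))) := by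
  have hd' : (d : ℝ) ≠ 0 := by positivity
  rw [volume_cube, ← ENNReal.rpow_natCast, ← ENNReal.rpow_mul, mul_div_cancel₀ _ hd',
    ENNReal.ofReal_rpow_of_nonneg (by positivity) hr.le]
  congr 1
  rw [← Real.rpow_intCast, ← Real.rpow_mul (by norm_num)]
  push_cast; ring_nf

/-- Coordinates that differ by less than the side length lie in the same or in adjacent dyadic
intervals. Thus one code point is close to at most 3^d cubes. -/
theorem abs_cubeIndex_sub_le {n : ℕ} {x a : EuclideanSpace ℝ (Fin d)}
    (h : ‖x - a‖ < (2 : ℝ) ^ (-(n : ℝ))) (i : Fin d) :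
    cubeIndex n x i ∈ Finset.Icc (cubeIndex n a i - 1) (cubeIndex n a i + 1) := by
  have h1 : |x i - a i| < (2 : ℝ) ^ (-(n : ℝ)) := by
    have := PiLp.norm_apply_le (x - a) i
    rw [PiLp.sub_apply, Real.norm_eq_abs] at this
    exact this.trans_lt h
  have h2 : (0 : ℝ) < 2 ^ n := by positivity
  rw [Real.rpow_neg (by norm_num), Real.rpow_natCast, ← one_div, lt_div_iff₀ h2,
    ← abs_of_pos h2, ← abs_mul, sub_mul, abs_lt] at h1
  have hx := Int.le_ceil (x i * 2 ^ n)
  have hx' := Int.ceil_lt_add_one (x i * 2 ^ n)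
  have ha := Int.le_ceil (a i * 2 ^ n)
  have ha' := Int.ceil_lt_add_one (a i * 2 ^ n)
  rw [Finset.mem_Icc]
  simp only [cubeIndex]
  constructor
  · have : ⌈a i * 2 ^ n⌉ < ⌈x i * 2 ^ n⌉ + 2 := by
      rw [← Int.cast_lt (R := ℝ)]; push_cast; linarith
    omega
  · have : ⌈x i * 2 ^ n⌉ < ⌈a i * 2 ^ n⌉ + 2 := by
      rw [← Int.cast_lt (R := ℝ)]; push_cast; linarith
    omega

theorem norm_le_of_forall_abs_le {x : EuclideanSpace ℝ (Fin d)} {c : ℝ} (hc : 0 ≤ c)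
    (h : ∀ i, |x i| ≤ c) : ‖x‖ ≤ d * c := by
  rw [EuclideanSpace.norm_eq]
  refine Real.sqrt_le_iff.2 ⟨by positivity, ?_⟩
  calc ∑ i, ‖x i‖ ^ 2 ≤ ∑ _i : Fin d, c ^ 2 :=
        Finset.sum_le_sum fun i _ => pow_le_pow_left₀ (norm_nonneg _) (h i) 2
    _ = d * c ^ 2 := by simp
    _ ≤ (d : ℝ) ^ 2 * c ^ 2 := by
        gcongr
        exact_mod_cast Nat.le_self_pow (by norm_num) d
    _ = (d * c) ^ 2 := by ring

/-- The upper corner of a cube. -/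
def corner (n : ℕ) (k : Fin d → ℤ) : EuclideanSpace ℝ (Fin d) :=
  WithLp.toLp 2 fun i => ((k i : ℝ) + 1) * (2 : ℝ) ^ (-(n : ℤ))

theorem norm_sub_corner_le {n : ℕ} {k : Fin d → ℤ} {x : EuclideanSpace ℝ (Fin d)}
    (hx : x ∈ cube d n k) : ‖x - corner n k‖ ≤ d * (2 : ℝ) ^ (-(n : ℝ)) := by
  refine norm_le_of_forall_abs_le (by positivity) fun i => ?_
  have := hx i
  simp only [PiLp.sub_apply, corner]
  rw [Real.rpow_neg (by norm_num), Real.rpow_natCast]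
  rw [zpow_neg, zpow_natCast] at *
  rw [abs_le]
  constructor <;> linarith [(by positivity : (0:ℝ) < (2 ^ n)⁻¹)]

/-- The index of the subcube of level `n + 1` of the cube with index `k`, in the direction `e`. -/
def childIndex (k : Fin d → ℤ) (e : Fin d → Fin 2) : Fin d → ℤ := fun i => 2 * k i + (e i : ℕ)

theorem exists_childIndex (n : ℕ) (x : EuclideanSpace ℝ (Fin d)) :
    ∃ e, cubeIndex (n + 1) x = childIndex (cubeIndex n x) e := by
  have key : ∀ i, ∃ e : Fin 2, cubeIndex (n + 1) x i = 2 * cubeIndex n x i + (e : ℕ) := by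
    intro i
    have h1 : ⌈x i * 2 ^ (n + 1)⌉ ≤ 2 * ⌈x i * 2 ^ n⌉ := by
      rw [Int.ceil_le]; push_cast; rw [pow_succ]; linarith [Int.le_ceil (x i * 2 ^ n)]
    have h2 : 2 * ⌈x i * 2 ^ n⌉ - 1 ≤ ⌈x i * 2 ^ (n + 1)⌉ := by
      have : 2 * ⌈x i * 2 ^ n⌉ - 2 < ⌈x i * 2 ^ (n + 1)⌉ := by
        rw [Int.lt_ceil]; push_cast; rw [pow_succ]; linarith [Int.ceil_lt_add_one (x i * 2 ^ n)]
      omega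
    simp only [cubeIndex]
    rcases (by omega : ⌈x i * 2 ^ (n + 1)⌉ = 2 * ⌈x i * 2 ^ n⌉ - 1 ∨
      ⌈x i * 2 ^ (n + 1)⌉ = 2 * ⌈x i * 2 ^ n⌉) with h | h
    · exact ⟨0, by simp; omega⟩
    · exact ⟨1, by simp; omega⟩
  choose e he using key
  exact ⟨e, funext he⟩

variable {ν : Measure (EuclideanSpace ℝ (Fin d))}

theorem exists_finset_of_isCompact_support (hν : IsCompact ν.support) :
    ∃ C : ℝ, 1 ≤ C ∧ ∀ n, ∃ s : Finset (Fin d → ℤ), (∀ k, ν (cube d n k) ≠ 0 → k ∈ s) ∧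
      (s.card : ℝ) ≤ C * (2 : ℝ) ^ (d * n : ℝ) := by
  obtain ⟨R, hR⟩ := hν.isBounded.exists_norm_le
  obtain ⟨M, hM⟩ := exists_nat_ge R
  refine ⟨(2 * M + 3 : ℝ) ^ d, one_le_pow₀ (by linarith [(Nat.cast_nonneg M : (0:ℝ) ≤ M)]),
    -- The index is a ceiling minus one, so it can fall to -M·2^n - 1; the extra 2^n at the lower
    -- end absorbs this.
    fun n => ⟨Fintype.piFinset fun _ => Finset.Icc (-((M + 1) * 2 ^ n : ℤ)) (M * 2 ^ n), ?_, ?_⟩⟩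
  · intro k hk
    obtain ⟨x, hx, hxs⟩ := Measure.nonempty_inter_support_of_pos (pos_iff_ne_zero.2 hk)
    rw [Fintype.mem_piFinset]
    intro i
    have h0 : |x i| ≤ M := ((PiLp.norm_apply_le x i).trans (hR x hxs)).trans hM
    have h2 : (0 : ℝ) < 2 ^ n := by positivity
    have h2' : (1 : ℝ) ≤ 2 ^ n := one_le_pow₀ (by norm_num)
    rw [abs_le] at h0
    rw [mem_cube_iff] at hx
    subst hx
    rw [Finset.mem_Icc]
    have hc := Int.ceil_lt_add_one (x i * 2 ^ n)
    have hc' := Int.le_ceil (x i * 2 ^ n)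
    constructor
    · have : ((-((M + 1) * 2 ^ n) : ℤ) : ℝ) ≤ ((cubeIndex n x i : ℤ) : ℝ) := by
        simp only [cubeIndex]; push_cast; nlinarith
      exact_mod_cast this
    · have : ((cubeIndex n x i : ℤ) : ℝ) ≤ ((M * 2 ^ n : ℤ) : ℝ) := by
        simp only [cubeIndex]; push_cast; nlinarith
      exact_mod_cast this
  · rw [Fintype.card_piFinset]
    simp only [Int.card_Icc, Finset.prod_const, Finset.card_univ, Fintype.card_fin]
    rw [mul_comm (d : ℝ), Real.rpow_mul (by norm_num), Real.rpow_natCast, Real.rpow_natCast,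
      ← mul_pow]
    push_cast
    refine pow_le_pow_left₀ (by positivity) ?_ _
    have : ((M * 2 ^ n + 1 - -((M + 1) * 2 ^ n) : ℤ).toNat : ℝ) =
        ((M * 2 ^ n + 1 - -((M + 1) * 2 ^ n) : ℤ) : ℝ) := by
      rw [← Int.cast_natCast, Int.toNat_of_nonneg]
      have : (0 : ℤ) ≤ M * 2 ^ n := by positivity
      have : (0 : ℤ) ≤ (M + 1) * 2 ^ n := by positivity
      linarith
    rw [this]
    push_cast
    have h2' : (1 : ℝ) ≤ 2 ^ n := one_le_pow₀ (by norm_num)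
    nlinarith

open scoped Classical in
/-- The indices of the cubes of level `n` with positive measure. -/
def chargedCubes (ν : Measure (EuclideanSpace ℝ (Fin d))) (n : ℕ) : Finset (Fin d → ℤ) :=
  if h : {k | ν (cube d n k) ≠ 0}.Finite then h.toFinset else ∅

theorem mem_chargedCubes (hν : IsCompact ν.support) {n : ℕ} {k : Fin d → ℤ} :
    k ∈ chargedCubes ν n ↔ ν (cube d n k) ≠ 0 := by
  obtain ⟨C, -, hC⟩ := exists_finset_of_isCompact_support hν
  obtain ⟨s, hs, -⟩ := hC n
  have h : {k | ν (cube d n k) ≠ 0}.Finite := s.finite_toSet.subset fun k hk => hs k hk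
  simp [chargedCubes, h]

theorem card_chargedCubes_le (hν : IsCompact ν.support) :
    ∃ C : ℝ, 1 ≤ C ∧ ∀ n, ((chargedCubes ν n).card : ℝ) ≤ C * (2 : ℝ) ^ (d * n : ℝ) := by
  obtain ⟨C, hC1, hC⟩ := exists_finset_of_isCompact_support hν
  refine ⟨C, hC1, fun n => ?_⟩
  obtain ⟨s, hs, hs'⟩ := hC n
  refine le_trans ?_ hs'
  exact_mod_cast Finset.card_le_card fun k hk => hs k ((mem_chargedCubes hν).1 hk)

theorem ae_mem_chargedCubes (hν : IsCompact ν.support) :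
    ∀ᵐ x ∂ν, ∀ n, cubeIndex n x ∈ chargedCubes ν n := by
  rw [ae_all_iff]
  intro n
  have : ν (cubeIndex n ⁻¹' {k | ν (cube d n k) = 0}) = 0 := by
    rw [measure_preimage_eq_zero_iff_of_countable (Set.to_countable _)]
    intro k hk
    rw [← cube_eq_preimage]; exact hk
  rw [ae_iff]
  refine measure_mono_null (fun x hx => ?_) this
  rw [mem_ofPred_eq, mem_chargedCubes hν, not_not] at hx
  exact hx

/-- The partition sum of order `q` over the cubes of level `n` with positive measure. -/
def momentSum (ν : Measure (EuclideanSpace ℝ (Fin d))) (n : ℕ) (q : ℝ) : ℝ :=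
  ∑ k ∈ chargedCubes ν n, ν.real (cube d n k) ^ q

variable [IsProbabilityMeasure ν]

theorem mass_pos (hν : IsCompact ν.support) {n : ℕ} {k : Fin d → ℤ} (hk : k ∈ chargedCubes ν n) :
    0 < ν.real (cube d n k) :=
  ENNReal.toReal_pos ((mem_chargedCubes hν).1 hk) (measure_ne_top _ _)

theorem partitionSum_eq (hν : IsCompact ν.support) (n : ℕ) (q : ℝ) :
    partitionSum ν n q = ENNReal.ofReal (momentSum ν n q) := by
  rw [momentSum, ENNReal.ofReal_sum_of_nonneg fun k _ => by positivity, partitionSum,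
    tsum_eq_sum (s := chargedCubes ν n)]
  · refine Finset.sum_congr rfl fun k hk => ?_
    rw [if_neg ((mem_chargedCubes hν).1 hk), ← ENNReal.ofReal_rpow_of_pos (mass_pos hν hk),
      measureReal_def, ENNReal.ofReal_toReal (measure_ne_top _ _)]
  · intro k hk
    rw [mem_chargedCubes hν, not_not] at hk
    rw [if_pos hk]

theorem momentSum_one (hν : IsCompact ν.support) (n : ℕ) : momentSum ν n 1 = 1 := by
  simp only [momentSum, Real.rpow_one]
  have h : ∑' k, ν (cube d n k) = 1 := by
    rw [← measure_iUnion (pairwise_disjoint_cube n) (measurableSet_cube n), iUnion_cube,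
      measure_univ]
  rw [tsum_eq_sum (s := chargedCubes ν n)] at h
  · have := congrArg ENNReal.toReal h
    rwa [ENNReal.toReal_sum fun k _ => measure_ne_top _ _] at this
  · intro k hk
    rwa [mem_chargedCubes hν, not_not] at hk

theorem momentSum_antitone (hν : IsCompact ν.support) (n : ℕ) : Antitone (momentSum ν n) :=
  fun _ _ h => Finset.sum_le_sum fun _ hk =>
    Real.rpow_le_rpow_of_exponent_ge (mass_pos hν hk) measureReal_le_one h

theorem one_le_momentSum (hν : IsCompact ν.support) (n : ℕ) {q : ℝ} (hq : q ≤ 1) :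
    1 ≤ momentSum ν n q := by
  rw [← momentSum_one hν n]
  exact momentSum_antitone hν n hq

theorem momentSum_pos (hν : IsCompact ν.support) (n : ℕ) (q : ℝ) : 0 < momentSum ν n q := by
  have h1 : (chargedCubes ν n).Nonempty := by
    rw [Finset.nonempty_iff_ne_empty]
    intro h
    have := momentSum_one hν n
    simp [momentSum, h] at this
  exact Finset.sum_pos (fun k hk => Real.rpow_pos_of_pos (mass_pos hν hk) _) h1

end

/-! ### Continuity of the L^q-spectrum and the critical exponent. -/

section

variable {d : ℕ}

theorem log_div_log_two_pow_le_iff {n : ℕ} (hn : 0 < n) {Z b : ℝ} (hZ : 0 < Z) :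
    Real.log Z / Real.log (2 ^ n) ≤ b ↔ Z ≤ 2 ^ (b * n) := by
  have h : 0 < Real.log ((2 : ℝ) ^ n) := Real.log_pos (one_lt_pow₀ (by norm_num) hn.ne')
  rw [div_le_iff₀ h, ← Real.log_le_log_iff hZ (by positivity), Real.log_pow,
    Real.log_rpow (by norm_num), mul_assoc]

theorem le_log_div_log_two_pow_iff {n : ℕ} (hn : 0 < n) {Z b : ℝ} (hZ : 0 < Z) :
    b ≤ Real.log Z / Real.log (2 ^ n) ↔ 2 ^ (b * n) ≤ Z := by
  have h : 0 < Real.log ((2 : ℝ) ^ n) := Real.log_pos (one_lt_pow₀ (by norm_num) hn.ne')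
  rw [le_div_iff₀ h, ← Real.log_le_log_iff (by positivity) hZ, Real.log_pow,
    Real.log_rpow (by norm_num), mul_assoc]

theorem eventually_le_two_rpow (K : ℝ) {ε : ℝ} (hε : 0 < ε) :
    ∀ᶠ n : ℕ in atTop, K ≤ (2 : ℝ) ^ (ε * n) := by
  have h : Tendsto (fun n : ℕ => ((2 : ℝ) ^ ε) ^ n) atTop atTop :=
    tendsto_pow_atTop_atTop_of_one_lt (Real.one_lt_rpow (by norm_num) hε)
  filter_upwards [h.eventually_ge_atTop K] with n hn
  rwa [Real.rpow_mul (by norm_num), Real.rpow_natCast]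

variable {ν : Measure (EuclideanSpace ℝ (Fin d))} {r : ℝ}

theorem critExp_nonneg : 0 ≤ critExp ν r := Real.sInf_nonneg fun _ h => h.1.le

theorem critExp_le {q : ℝ} (hq : 0 < q) (h : beta ν q < ((r * q : ℝ) : EReal)) :
    critExp ν r ≤ q := csInf_le ⟨0, fun _ h => h.1.le⟩ ⟨hq, h⟩

theorem le_beta_of_lt_critExp {q : ℝ} (hq0 : 0 < q) (hq : q < critExp ν r) :
    ((r * q : ℝ) : EReal) ≤ beta ν q :=
  not_lt.1 fun h => hq.not_ge (critExp_le hq0 h)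

variable [IsProbabilityMeasure ν]

theorem betaLevel_eq (hν : IsCompact ν.support) (n : ℕ) (q : ℝ) :
    betaLevel ν n q = ((Real.log (momentSum ν n q) / Real.log (2 ^ n) : ℝ) : EReal) := by
  rw [betaLevel, partitionSum_eq hν, ENNReal.log_ofReal_of_pos (momentSum_pos hν n q),
    EReal.coe_div]

theorem eventually_momentSum_le (hν : IsCompact ν.support) {q b : ℝ} (h : beta ν q < b) :
    ∀ᶠ n : ℕ in atTop, momentSum ν n q ≤ 2 ^ (b * n) := by
  filter_upwards [eventually_lt_of_limsup_lt h, eventually_gt_atTop 0] with n hn hn0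
  rw [betaLevel_eq hν] at hn
  exact (log_div_log_two_pow_le_iff hn0 (momentSum_pos hν n q)).1 (EReal.coe_lt_coe_iff.1 hn).le

theorem eventually_le_momentSum (hν : IsCompact ν.support) {q b : ℝ} (h : b < betaLower ν q) :
    ∀ᶠ n : ℕ in atTop, 2 ^ (b * n) ≤ momentSum ν n q := by
  filter_upwards [eventually_lt_of_lt_liminf h, eventually_gt_atTop 0] with n hn hn0
  rw [betaLevel_eq hν] at hn
  exact (le_log_div_log_two_pow_iff hn0 (momentSum_pos hν n q)).1 (EReal.coe_lt_coe_iff.1 hn).le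

theorem frequently_le_momentSum (hν : IsCompact ν.support) {q b : ℝ} (h : b < beta ν q) :
    ∃ᶠ n : ℕ in atTop, 2 ^ (b * n) ≤ momentSum ν n q := by
  refine ((frequently_lt_of_lt_limsup (by isBoundedDefault) h).and_eventually
    (eventually_gt_atTop 0)).mono fun n hn => ?_
  have h1 := hn.1
  rw [betaLevel_eq hν] at h1
  exact (le_log_div_log_two_pow_iff hn.2 (momentSum_pos hν n q)).1 (EReal.coe_lt_coe_iff.1 h1).le

theorem beta_le_of_eventually (hν : IsCompact ν.support) {q b : ℝ}
    (h : ∀ᶠ n : ℕ in atTop, momentSum ν n q ≤ 2 ^ (b * n)) : beta ν q ≤ b := by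
  refine limsup_le_of_le (by isBoundedDefault) ?_
  filter_upwards [h, eventually_gt_atTop 0] with n hn hn0
  rw [betaLevel_eq hν]
  exact EReal.coe_le_coe_iff.2 ((log_div_log_two_pow_le_iff hn0 (momentSum_pos hν n q)).2 hn)

/-- Split the cubes at mass θ. The light ones contribute at most θ^p each, a bounded total because
there are O(2^{dn}) cubes; on the heavy ones m^p ≤ θ^{p-q} m^q. The bounded part is absorbed because
the moment of order q ≤ 1 is at least 1. This is the source of the continuity of β on (0,1]. -/
theorem momentSum_le_mul (hν : IsCompact ν.support) :
    ∃ C : ℝ, 0 < C ∧ ∀ n (p q : ℝ), 0 < p → p ≤ q → q ≤ 1 →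
      momentSum ν n p ≤ C * 2 ^ (d * (q - p) / p * n) * momentSum ν n q := by
  obtain ⟨C, hC1, hC⟩ := card_chargedCubes_le hν
  refine ⟨C + 1, by positivity, fun n p q hp hpq hq => ?_⟩
  -- Chosen so that θ^p = 2^{-dn} cancels the number of cubes.
  set θ : ℝ := 2 ^ (-(d / p * n)) with hθ
  have hθ0 : 0 < θ := by positivity
  have hE : (1 : ℝ) ≤ 2 ^ (d * (q - p) / p * n) :=
    Real.one_le_rpow (by norm_num)
      (mul_nonneg (div_nonneg (mul_nonneg (by positivity) (by linarith)) hp.le) (by positivity))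
  have hpt : ∀ k ∈ chargedCubes ν n, ν.real (cube d n k) ^ p ≤
      2 ^ (-(d * n : ℝ)) + 2 ^ (d * (q - p) / p * n) * ν.real (cube d n k) ^ q := by
    intro k hk
    have hm := mass_pos hν hk
    rcases le_total (ν.real (cube d n k)) θ with h | h
    · have : ν.real (cube d n k) ^ p ≤ 2 ^ (-(d * n : ℝ)) := by
        calc ν.real (cube d n k) ^ p ≤ θ ^ p := Real.rpow_le_rpow hm.le h hp.le
          _ = 2 ^ (-(d * n : ℝ)) := by
            rw [hθ, ← Real.rpow_mul (by norm_num)]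
            congr 1; field_simp
      have h2 : 0 ≤ 2 ^ (d * (q - p) / p * n) * ν.real (cube d n k) ^ q := by positivity
      linarith
    · have : ν.real (cube d n k) ^ p ≤
          2 ^ (d * (q - p) / p * n) * ν.real (cube d n k) ^ q := by
        calc ν.real (cube d n k) ^ p
            = ν.real (cube d n k) ^ (-(q - p)) * ν.real (cube d n k) ^ q := by
              rw [← Real.rpow_add hm]; ring_nf
          _ ≤ θ ^ (-(q - p)) * ν.real (cube d n k) ^ q := by
              gcongr ?_ * _
              exact Real.rpow_le_rpow_of_nonpos hθ0 h (by linarith)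
          _ = _ := by
              rw [hθ, ← Real.rpow_mul (by norm_num)]
              congr 2; field_simp
      have h2 : (0 : ℝ) ≤ 2 ^ (-(d * n : ℝ)) := by positivity
      linarith
  calc momentSum ν n p
      ≤ ∑ k ∈ chargedCubes ν n, (2 ^ (-(d * n : ℝ)) +
          2 ^ (d * (q - p) / p * n) * ν.real (cube d n k) ^ q) := Finset.sum_le_sum hpt
    _ = (chargedCubes ν n).card * 2 ^ (-(d * n : ℝ)) +
          2 ^ (d * (q - p) / p * n) * momentSum ν n q := by
        rw [Finset.sum_add_distrib, ← Finset.mul_sum, Finset.sum_const, nsmul_eq_mul]; rfl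
    _ ≤ C + 2 ^ (d * (q - p) / p * n) * momentSum ν n q := by
        gcongr
        calc ((chargedCubes ν n).card : ℝ) * 2 ^ (-(d * n : ℝ))
            ≤ C * 2 ^ (d * n : ℝ) * 2 ^ (-(d * n : ℝ)) := by gcongr; exact hC n
          _ = C := by rw [mul_assoc, ← Real.rpow_add (by norm_num)]; simp
    _ ≤ C * (2 ^ (d * (q - p) / p * n) * momentSum ν n q) +
          2 ^ (d * (q - p) / p * n) * momentSum ν n q := by
        gcongr
        exact le_mul_of_one_le_right (by linarith)
          (one_le_mul_of_one_le_of_one_le hE (one_le_momentSum hν n hq))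
    _ = _ := by ring

theorem beta_nonneg (hν : IsCompact ν.support) {q : ℝ} (hq : q ≤ 1) : 0 ≤ beta ν q := by
  refine le_limsup_of_le (by isBoundedDefault) fun b hb => ?_
  obtain ⟨n, hn⟩ := hb.exists
  refine le_trans ?_ hn
  rw [betaLevel_eq hν]
  exact EReal.coe_nonneg.2 (div_nonneg (Real.log_nonneg (one_le_momentSum hν n hq))
    (Real.log_nonneg (one_le_pow₀ (by norm_num))))

theorem beta_antitone (hν : IsCompact ν.support) : Antitone (beta ν) := by
  intro p q hpq
  refine EReal.le_of_forall_lt_iff_le.1 fun z hz => beta_le_of_eventually hν ?_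
  filter_upwards [eventually_momentSum_le hν hz] with n hn
  exact (momentSum_antitone hν n hpq).trans hn

theorem beta_one (hν : IsCompact ν.support) : beta ν 1 = 0 := by
  refine le_antisymm ?_ (beta_nonneg hν le_rfl)
  refine beta_le_of_eventually (b := 0) hν (Eventually.of_forall fun n => ?_)
  simp [momentSum_one hν]

theorem beta_le_add_of_lt (hν : IsCompact ν.support) {p q b : ℝ} (hp : 0 < p) (hpq : p ≤ q)
    (hq : q ≤ 1) (hb : beta ν q < b) : beta ν p ≤ ((b + d * (q - p) / p : ℝ) : EReal) := by
  obtain ⟨C, hC0, hC⟩ := momentSum_le_mul hν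
  refine EReal.le_of_forall_lt_iff_le.1 fun z hz => beta_le_of_eventually hν ?_
  have hz' := EReal.coe_lt_coe_iff.1 hz
  filter_upwards [eventually_momentSum_le hν hb, eventually_le_two_rpow C (sub_pos.2 hz')]
    with n hn hn'
  calc momentSum ν n p ≤ C * 2 ^ (d * (q - p) / p * n) * momentSum ν n q := hC n p q hp hpq hq
    _ ≤ 2 ^ ((z - (b + d * (q - p) / p)) * n) * 2 ^ (d * (q - p) / p * n) * 2 ^ (b * n) := by
        have := (momentSum_pos hν n q).le
        gcongr
    _ = 2 ^ (z * n) := by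
        rw [← Real.rpow_add (by norm_num), ← Real.rpow_add (by norm_num)]
        congr 1; ring

/-- The `L^q`-spectrum as a real number; see `coe_betaReal`. -/
def betaReal (ν : Measure (EuclideanSpace ℝ (Fin d))) (q : ℝ) : ℝ := (beta ν q).toReal

theorem coe_betaReal (hν : IsCompact ν.support) {q : ℝ} (hq0 : 0 < q) (hq : q ≤ 1) :
    (betaReal ν q : EReal) = beta ν q := by
  refine EReal.coe_toReal ?_ ?_
  · have := beta_le_add_of_lt hν hq0 hq le_rfl (b := 1) (by rw [beta_one hν]; norm_num)
    exact ne_top_of_le_ne_top (EReal.coe_ne_top _) this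
  · exact ne_bot_of_le_ne_bot (by simp) (beta_nonneg hν hq)

/-- With monotonicity this makes β locally Lipschitz on (0,1]. The constant blows up at 0, which is
why c = 0 is treated separately later. -/
theorem betaReal_le_add (hν : IsCompact ν.support) {p q : ℝ} (hp : 0 < p) (hpq : p ≤ q)
    (hq : q ≤ 1) : betaReal ν p ≤ betaReal ν q + d * (q - p) / p := by
  refine le_of_forall_pos_le_add fun ε hε => ?_
  have := beta_le_add_of_lt hν hp hpq hq (b := betaReal ν q + ε) (by
    rw [← coe_betaReal hν (hp.trans_le hpq) hq, EReal.coe_lt_coe_iff]; linarith)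
  rw [← coe_betaReal hν hp (hpq.trans hq), EReal.coe_le_coe_iff] at this
  linarith

theorem betaReal_antitoneOn (hν : IsCompact ν.support) : AntitoneOn (betaReal ν) (Ioc 0 1) := by
  intro p hp q hq hpq
  rw [← EReal.coe_le_coe_iff, coe_betaReal hν hp.1 hp.2, coe_betaReal hν hq.1 hq.2]
  exact beta_antitone hν hpq

theorem betaReal_one (hν : IsCompact ν.support) : betaReal ν 1 = 0 := by
  simp [betaReal, beta_one hν]

/-- As q increases to 1, β(q) ≤ d(1-q)/q tends to 0 while rq tends to r > 0, so some q < 1 is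
admissible. -/
theorem critExp_lt_one (hν : IsCompact ν.support) (hr : 0 < r) : critExp ν r < 1 := by
  have h : ∀ᶠ q : ℝ in 𝓝[<] 1, 0 + d * (1 - q) / q < r * q := by
    refine Tendsto.eventually_lt (y := 0) (z := r) ?_ ?_ hr
    · refine Tendsto.mono_left ?_ nhdsWithin_le_nhds
      have : ContinuousAt (fun q : ℝ => 0 + d * (1 - q) / q) 1 := by
        fun_prop (disch := norm_num)
      simpa [ContinuousAt] using this
    · refine Tendsto.mono_left ?_ nhdsWithin_le_nhds
      have : ContinuousAt (fun q : ℝ => r * q) 1 := by fun_prop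
      simpa [ContinuousAt] using this
  obtain ⟨q, hq, hq0, hq1⟩ := (h.and (Ioo_mem_nhdsLT (zero_lt_one (α := ℝ)))).exists
  refine (critExp_le hq0 ?_).trans_lt hq1
  have hq1' : q ≤ 1 := le_of_lt hq1
  rw [← coe_betaReal hν hq0 hq1', EReal.coe_lt_coe_iff]
  refine lt_of_le_of_lt ?_ hq
  rw [← betaReal_one hν]
  exact betaReal_le_add hν hq0 hq1' le_rfl

theorem exists_beta_lt (hν : IsCompact ν.support) (hr : 0 < r) {b : ℝ} (hb : critExp ν r < b) :
    ∃ q, 0 < q ∧ critExp ν r ≤ q ∧ q < b ∧ beta ν q < ((r * q : ℝ) : EReal) := by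
  obtain ⟨q, ⟨hq0, hq⟩, hqb⟩ := exists_lt_of_csInf_lt (s := {q : ℝ | 0 < q ∧
    beta ν q < ((r * q : ℝ) : EReal)}) ⟨1, one_pos, by rw [beta_one hν]; simpa using hr⟩ hb
  exact ⟨q, hq0, critExp_le hq0 hq, hqb, hq⟩

/-- Admissible points decrease to c and no positive point below c is admissible; continuity of β at
c > 0 turns these two facts into the two inequalities. -/
theorem beta_critExp (hν : IsCompact ν.support) (hr : 0 < r) (h0 : 0 < critExp ν r) :
    beta ν (critExp ν r) = ((r * critExp ν r : ℝ) : EReal) := by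
  have h1 := critExp_lt_one (r := r) hν hr
  set c := critExp ν r with hc
  rw [← coe_betaReal hν h0 h1.le, EReal.coe_eq_coe_iff]
  refine le_antisymm ?_ ?_
  · have hlim : Tendsto (fun b : ℝ => r * b + d * (b - c) / c) (𝓝[>] c) (𝓝 (r * c)) := by
      refine Tendsto.mono_left ?_ nhdsWithin_le_nhds
      have : ContinuousAt (fun b : ℝ => r * b + d * (b - c) / c) c := by fun_prop
      simpa [ContinuousAt] using this
    refine ge_of_tendsto hlim ?_
    filter_upwards [self_mem_nhdsWithin, nhdsWithin_le_nhds (Iio_mem_nhds h1)] with b hb hb1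
    obtain ⟨q, hq0, hcq, hqb, hq⟩ := exists_beta_lt hν hr hb
    have hq1 : q ≤ 1 := (hqb.trans hb1).le
    rw [← coe_betaReal hν hq0 hq1, EReal.coe_lt_coe_iff] at hq
    have := betaReal_le_add hν h0 hcq hq1
    have h2 : d * (q - c) / c ≤ d * (b - c) / c := by gcongr
    nlinarith
  · have hlim : Tendsto (fun b : ℝ => r * b - d * (c - b) / b) (𝓝[<] c) (𝓝 (r * c)) := by
      refine Tendsto.mono_left ?_ nhdsWithin_le_nhds
      have : ContinuousAt (fun b : ℝ => r * b - d * (c - b) / b) c := by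
        fun_prop (disch := exact h0.ne')
      simpa [ContinuousAt] using this
    refine le_of_tendsto hlim ?_
    filter_upwards [self_mem_nhdsWithin, nhdsWithin_le_nhds (Ioi_mem_nhds h0)] with b hb hb0
    have hb' : b < c := hb
    have h2 := le_beta_of_lt_critExp hb0 hb
    rw [← coe_betaReal hν hb0 (hb'.trans h1).le, EReal.coe_le_coe_iff] at h2
    linarith [betaReal_le_add hν hb0 hb'.le h1.le]

end

/-! ### Coarse multifractal dimensions; the upper one equals the critical exponent. -/

section

variable {d : ℕ}

/-- The indices of the cubes `Q` of level `n` with `ν(Q) Λ(Q)^{r/d} ≥ 2^{-αn}`. -/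
def bigCubes (ν : Measure (EuclideanSpace ℝ (Fin d))) (r α : ℝ) (n : ℕ) :
    Finset (Fin d → ℤ) :=
  (chargedCubes ν n).filter fun k =>
    (2 : ℝ) ^ (-(α * n)) ≤ ν.real (cube d n k) * 2 ^ (-(n * r))

variable {ν : Measure (EuclideanSpace ℝ (Fin d))} {r : ℝ}

theorem coarseRatio_nonneg (n : ℕ) (α : ℝ) : 0 ≤ coarseRatio ν r α n :=
  EReal.div_nonneg (le_max_left _ _)
    (EReal.coe_nonneg.2 (Real.log_nonneg (one_le_pow₀ (by norm_num))))

theorem lowerF_le_upperF : lowerF ν r ≤ upperF ν r :=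
  iSup₂_mono fun _ hα => EReal.div_le_div_right_of_nonneg (EReal.coe_nonneg.2 hα.le)
    (liminf_le_limsup (by isBoundedDefault) (by isBoundedDefault))

theorem lowerF_nonneg : 0 ≤ lowerF ν r := by
  refine le_iSup₂_of_le 1 one_pos (EReal.div_nonneg ?_ (EReal.coe_nonneg.2 zero_le_one))
  exact le_liminf_of_le (by isBoundedDefault)
    (Eventually.of_forall fun n => coarseRatio_nonneg n 1)

theorem sum_mass_mul_rpow (n : ℕ) (q : ℝ) :
    ∑ k ∈ chargedCubes ν n, (ν.real (cube d n k) * 2 ^ (-(n * r))) ^ q =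
      momentSum ν n q * 2 ^ (-(r * q * n)) := by
  rw [momentSum, Finset.sum_mul]
  refine Finset.sum_congr rfl fun k _ => ?_
  rw [Real.mul_rpow measureReal_nonneg (by positivity), ← Real.rpow_mul (by norm_num)]
  congr 2; ring

/-- Markov's inequality. -/
theorem card_filter_le (n : ℕ) {t q : ℝ} (ht : 0 < t) (hq : 0 < q) :
    (((chargedCubes ν n).filter fun k => t ≤ ν.real (cube d n k) * 2 ^ (-(n * r))).card : ℝ) ≤
      t ^ (-q) * (momentSum ν n q * 2 ^ (-(r * q * n))) := by
  rw [← sum_mass_mul_rpow, Real.rpow_neg ht.le, ← div_eq_inv_mul,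
    le_div_iff₀ (by positivity), ← nsmul_eq_mul]
  refine (Finset.card_nsmul_le_sum _ _ _ fun k hk => ?_).trans
    (Finset.sum_le_sum_of_subset_of_nonneg (Finset.filter_subset _ _) fun k _ _ => by positivity)
  exact Real.rpow_le_rpow ht.le (Finset.mem_filter.1 hk).2 hq.le

variable [IsProbabilityMeasure ν]

/-- Null cubes never reach the positive threshold, so restricting to charged cubes loses nothing. -/
theorem cubeCount_eq (hν : IsCompact ν.support) (hd : 0 < d) (hr : 0 < r) (α : ℝ) (n : ℕ) :
    cubeCount ν r α n = ((bigCubes ν r α n).card : ℕ∞) := by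
  rw [cubeCount, ← Set.encard_coe_eq_coe_finsetCard]
  congr 1
  ext k
  rw [mem_ofPred_eq, Finset.mem_coe, bigCubes, Finset.mem_filter, mem_chargedCubes hν,
    volume_cube_rpow hd n k hr]
  have h2 : (2 : ℝ≥0∞) ^ (-(α * n)) = ENNReal.ofReal ((2 : ℝ) ^ (-(α * n))) := by
    rw [← ENNReal.ofReal_rpow_of_pos (by norm_num)]; simp
  have hm : ν (cube d n k) = ENNReal.ofReal (ν.real (cube d n k)) :=
    (ofReal_measureReal (measure_ne_top _ _)).symm
  have h : (2 : ℝ≥0∞) ^ (-(α * n)) ≤ ν (cube d n k) * ENNReal.ofReal (2 ^ (-(n * r))) ↔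
      (2 : ℝ) ^ (-(α * n)) ≤ ν.real (cube d n k) * 2 ^ (-(n * r)) := by
    rw [hm, h2, ← ENNReal.ofReal_mul measureReal_nonneg,
      ENNReal.ofReal_le_ofReal_iff (by positivity)]
  rw [h]
  refine ⟨fun h' => ⟨fun h0 => ?_, h'⟩, fun h' => h'.2⟩
  have : ν.real (cube d n k) = 0 := by simp [measureReal_def, h0]
  rw [this, zero_mul] at h'
  exact absurd h' (not_le.2 (by positivity))

theorem coarseRatio_eq (hν : IsCompact ν.support) (hd : 0 < d) (hr : 0 < r) (α : ℝ) (n : ℕ) :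
    coarseRatio ν r α n =
      ((Real.log (bigCubes ν r α n).card / Real.log (2 ^ n) : ℝ) : EReal) := by
  rw [coarseRatio, cubeCount_eq hν hd hr, EReal.coe_div]
  congr 1
  have hcast : (((bigCubes ν r α n).card : ℕ∞) : ℝ≥0∞) =
      ENNReal.ofReal ((bigCubes ν r α n).card : ℝ) := by simp
  rw [hcast]
  rcases Nat.eq_zero_or_pos (bigCubes ν r α n).card with h | h
  · simp [h]
  · have h1 : (1 : ℝ) ≤ (bigCubes ν r α n).card := by exact_mod_cast h
    rw [ENNReal.log_ofReal_of_pos (by linarith), max_eq_right]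
    exact EReal.coe_nonneg.2 (Real.log_nonneg h1)

theorem eventually_le_card (hν : IsCompact ν.support) (hd : 0 < d) (hr : 0 < r) {α s : ℝ}
    (hs : 0 ≤ s) (h : s < liminf (fun n : ℕ => coarseRatio ν r α n) atTop) :
    ∀ᶠ n : ℕ in atTop, 2 ^ (s * n) ≤ ((bigCubes ν r α n).card : ℝ) := by
  filter_upwards [eventually_lt_of_lt_liminf h, eventually_gt_atTop 0] with n hn hn0
  rw [coarseRatio_eq hν hd hr, EReal.coe_lt_coe_iff] at hn
  -- For an empty family the real convention log 0 = 0 gives ratio 0, in agreement with log⁺; `hs`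
  -- then excludes it.
  rcases Nat.eq_zero_or_pos (bigCubes ν r α n).card with h | h
  · simp only [h, Nat.cast_zero, Real.log_zero, zero_div] at hn
    linarith
  · exact (le_log_div_log_two_pow_iff hn0 (by exact_mod_cast h)).1 hn.le

theorem eventually_card_le (hν : IsCompact ν.support) (hd : 0 < d) (hr : 0 < r) {α s : ℝ}
    (h : limsup (fun n : ℕ => coarseRatio ν r α n) atTop < s) :
    ∀ᶠ n : ℕ in atTop, ((bigCubes ν r α n).card : ℝ) ≤ 2 ^ (s * n) := by
  filter_upwards [eventually_lt_of_limsup_lt h, eventually_gt_atTop 0] with n hn hn0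
  rw [coarseRatio_eq hν hd hr, EReal.coe_lt_coe_iff] at hn
  rcases Nat.eq_zero_or_pos (bigCubes ν r α n).card with h | h
  · rw [h, Nat.cast_zero]; positivity
  · exact (log_div_log_two_pow_le_iff hn0 (by exact_mod_cast h)).1 hn.le

theorem le_liminf_coarseRatio (hν : IsCompact ν.support) (hd : 0 < d) (hr : 0 < r) {α s : ℝ}
    (h : ∀ᶠ n : ℕ in atTop, 2 ^ (s * n) ≤ ((bigCubes ν r α n).card : ℝ)) :
    s ≤ liminf (fun n : ℕ => coarseRatio ν r α n) atTop := by
  refine le_liminf_of_le (by isBoundedDefault) ?_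
  filter_upwards [h, eventually_gt_atTop 0] with n hn hn0
  rw [coarseRatio_eq hν hd hr, EReal.coe_le_coe_iff,
    le_log_div_log_two_pow_iff hn0 (lt_of_lt_of_le (by positivity) hn)]
  exact hn

theorem limsup_coarseRatio_le (hν : IsCompact ν.support) (hd : 0 < d) (hr : 0 < r) {α s : ℝ}
    (hs : 0 ≤ s) (h : ∀ᶠ n : ℕ in atTop, ((bigCubes ν r α n).card : ℝ) ≤ 2 ^ (s * n)) :
    limsup (fun n : ℕ => coarseRatio ν r α n) atTop ≤ s := by
  refine limsup_le_of_le (by isBoundedDefault) ?_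
  filter_upwards [h, eventually_gt_atTop 0] with n hn hn0
  rw [coarseRatio_eq hν hd hr, EReal.coe_le_coe_iff]
  rcases Nat.eq_zero_or_pos (bigCubes ν r α n).card with h | h
  · simpa [h] using hs
  · exact (log_div_log_two_pow_le_iff hn0 (by exact_mod_cast h)).2 hn

theorem upperF_le_critExp (hν : IsCompact ν.support) (hd : 0 < d) (hr : 0 < r) :
    upperF ν r ≤ critExp ν r := by
  refine EReal.le_of_forall_lt_iff_le.1 fun b hb => ?_
  obtain ⟨q, hq0, -, hqb, hq⟩ := exists_beta_lt hν hr (EReal.coe_lt_coe_iff.1 hb)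
  refine (iSup₂_le fun α hα => ?_ : upperF ν r ≤ q).trans (EReal.coe_le_coe_iff.2 hqb.le)
  rw [EReal.div_le_iff_le_mul (EReal.coe_pos.2 hα) (EReal.coe_ne_top _), ← EReal.coe_mul]
  refine limsup_coarseRatio_le hν hd hr (by positivity) ?_
  filter_upwards [eventually_momentSum_le hν hq] with n hn
  refine (card_filter_le n (by positivity) hq0).trans ?_
  calc ((2 : ℝ) ^ (-(α * n))) ^ (-q) * (momentSum ν n q * 2 ^ (-(r * q * n)))
      ≤ ((2 : ℝ) ^ (-(α * n))) ^ (-q) * (2 ^ (r * q * n) * 2 ^ (-(r * q * n))) := by gcongr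
    _ = 2 ^ (α * q * n) := by
      rw [← Real.rpow_mul (by norm_num), ← Real.rpow_add (by norm_num),
        ← Real.rpow_add (by norm_num)]
      congr 1; ring

/-- Layer cake bound for `x ^ q` along a decreasing sequence of thresholds. -/
theorem rpow_le_add_sum_ite {u : ℕ → ℝ} (hu : ∀ i, 0 < u i) {x q : ℝ} (hx : 0 ≤ x) (hq : 0 ≤ q)
    (hx0 : x ≤ u 0) (K : ℕ) :
    x ^ q ≤ u K ^ q + ∑ i ∈ Finset.range K, if u (i + 1) ≤ x then u i ^ q else 0 := by
  induction K with
  | zero => simpa using Real.rpow_le_rpow hx hx0 hq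
  | succ K ih =>
    rw [Finset.sum_range_succ]
    split_ifs with h
    · have := Real.rpow_nonneg (hu (K + 1)).le q
      linarith
    · have h1 := Real.rpow_le_rpow hx (not_le.1 h).le hq
      have h2 : 0 ≤ ∑ i ∈ Finset.range K, if u (i + 1) ≤ x then u i ^ q else 0 :=
        Finset.sum_nonneg fun i _ => by
          split_ifs
          exacts [Real.rpow_nonneg (hu i).le q, le_rfl]
      linarith

/-- Otherwise take s < q strictly between the two numbers. At most 2^{sαn} cubes satisfy J ≥
2^{-αn}, so each of finitely many layers of J contributes a bounded amount to the sum of J^q. But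
that sum grows exponentially along a subsequence, because β(q) > rq. -/
theorem critExp_le_upperF (hν : IsCompact ν.support) (hd : 0 < d) (hr : 0 < r) :
    critExp ν r ≤ upperF ν r := by
  by_contra! hlt
  obtain ⟨s, hs, hsc⟩ := EReal.lt_iff_exists_real_btwn.1 hlt
  rw [EReal.coe_lt_coe_iff] at hsc
  have hs0 : 0 < s := by
    have := (lowerF_nonneg.trans lowerF_le_upperF).trans_lt hs
    exact EReal.coe_pos.1 this
  obtain ⟨q, hsq, hqc⟩ := exists_between hsc
  -- The auxiliary q' gives the strict gap: β(q) ≥ β(q') ≥ rq' > b > rq.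
  obtain ⟨q', hqq', hqc'⟩ := exists_between hqc
  have hq0 : 0 < q := hs0.trans hsq
  obtain ⟨b, hqb, hbq⟩ := exists_between (mul_lt_mul_of_pos_left hqq' hr)
  have hfreq : ∃ᶠ n : ℕ in atTop, 2 ^ (b * n) ≤ momentSum ν n q := by
    refine frequently_le_momentSum hν ?_
    calc (b : EReal) < ((r * q' : ℝ) : EReal) := EReal.coe_lt_coe_iff.2 hbq
      _ ≤ beta ν q' := le_beta_of_lt_critExp (hq0.trans hqq') hqc'
      _ ≤ beta ν q := beta_antitone hν hqq'.le
  -- Layers this thin satisfy s·a(i+1) ≤ q·a(i), since a(i) ≥ r; each layer then contributes at most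
  -- 1.
  obtain ⟨η, hη0, hη⟩ : ∃ η : ℝ, 0 < η ∧ s * η ≤ (q - s) * r := by
    refine ⟨(q - s) * r / s, by have := sub_pos.2 hsq; positivity, ?_⟩
    rw [mul_div_cancel₀ _ hs0.ne']
  -- Ensures q·a(K) ≥ d, so that all charged cubes together contribute at most C below the last
  -- threshold.
  obtain ⟨K, hK⟩ := exists_nat_ge (d / (η * q))
  set a : ℕ → ℝ := fun i => r + i * η with ha
  have ha0 : ∀ i, 0 < a i := fun i => by positivity
  obtain ⟨C, hC1, hC⟩ := card_chargedCubes_le hν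
  have hcount : ∀ᶠ n : ℕ in atTop, ∀ i ∈ Finset.range K,
      ((bigCubes ν r (a (i + 1)) n).card : ℝ) ≤ 2 ^ (s * a (i + 1) * n) := by
    rw [Filter.eventually_all_finset]
    intro i _
    refine eventually_card_le hν hd hr ?_
    rw [EReal.coe_mul, ← EReal.div_lt_iff (EReal.coe_pos.2 (ha0 _)) (EReal.coe_ne_top _)]
    exact lt_of_le_of_lt (le_iSup₂_of_le (a (i + 1)) (ha0 _) le_rfl) hs
  obtain ⟨n, hn, hn1, hn2⟩ := (hfreq.and_eventually
    (hcount.and (eventually_le_two_rpow (C + K + 1) (sub_pos.2 hqb)))).exists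
  have hbound : momentSum ν n q * 2 ^ (-(r * q * n)) ≤ C + K := by
    rw [← sum_mass_mul_rpow]
    set u : ℕ → ℝ := fun i => 2 ^ (-(a i * n)) with hu
    calc ∑ k ∈ chargedCubes ν n, (ν.real (cube d n k) * 2 ^ (-(n * r))) ^ q
        ≤ ∑ k ∈ chargedCubes ν n, (u K ^ q + ∑ i ∈ Finset.range K,
            if u (i + 1) ≤ ν.real (cube d n k) * 2 ^ (-(n * r)) then u i ^ q else 0) := by
          refine Finset.sum_le_sum fun k _ => rpow_le_add_sum_ite (fun i => by positivity)
            (by positivity) hq0.le ?_ K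
          calc ν.real (cube d n k) * 2 ^ (-(n * r)) ≤ 1 * 2 ^ (-(n * r)) := by
                gcongr; exact measureReal_le_one
            _ = u 0 := by simp [hu, ha, mul_comm]
      _ = (chargedCubes ν n).card * u K ^ q + ∑ i ∈ Finset.range K,
            (bigCubes ν r (a (i + 1)) n).card * u i ^ q := by
          rw [Finset.sum_add_distrib, Finset.sum_const, nsmul_eq_mul, Finset.sum_comm]
          congr 1
          refine Finset.sum_congr rfl fun i _ => ?_
          rw [← Finset.sum_filter, Finset.sum_const, nsmul_eq_mul]
          rfl
      _ ≤ C * 2 ^ (d * n : ℝ) * 2 ^ (-(d * n : ℝ)) + ∑ i ∈ Finset.range K, (1 : ℝ) := by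
          gcongr with i hi
          · exact hC n
          · rw [hu, ← Real.rpow_mul (by norm_num)]
            refine Real.rpow_le_rpow_of_exponent_le (by norm_num) ?_
            rw [div_le_iff₀ (by positivity)] at hK
            have h1 : (d : ℝ) ≤ a K * q := by
              simp only [ha]; nlinarith [mul_pos hr hq0]
            have h2 : (0 : ℝ) ≤ n := by positivity
            nlinarith
          · calc ((bigCubes ν r (a (i + 1)) n).card : ℝ) * u i ^ q
                ≤ 2 ^ (s * a (i + 1) * n) * u i ^ q := by gcongr; exact hn1 i hi
              _ = 2 ^ ((s * a (i + 1) - a i * q) * n) := by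
                rw [hu, ← Real.rpow_mul (by norm_num), ← Real.rpow_add (by norm_num)]
                congr 1; ring
              _ ≤ 1 := by
                refine Real.rpow_le_one_of_one_le_of_nonpos (by norm_num) ?_
                refine mul_nonpos_of_nonpos_of_nonneg ?_ (by positivity)
                simp only [ha]; push_cast
                have h3 : 0 ≤ (q - s) * (i * η) :=
                  mul_nonneg (sub_pos.2 hsq).le (by positivity)
                nlinarith
      _ = C + K := by
          rw [mul_assoc, ← Real.rpow_add (by norm_num)]; simp
  have hlow : 2 ^ ((b - r * q) * n) ≤ momentSum ν n q * 2 ^ (-(r * q * n)) := by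
    calc (2 : ℝ) ^ ((b - r * q) * n) = 2 ^ (b * n) * 2 ^ (-(r * q * n)) := by
          rw [← Real.rpow_add (by norm_num)]; congr 1; ring
      _ ≤ _ := by gcongr
  linarith

/-! ### Lower coarse dimension under L^q-regularity. -/

theorem le_lowerF_of_eventually (hν : IsCompact ν.support) (hd : 0 < d) (hr : 0 < r) {α s : ℝ}
    (hα : 0 < α) (h : ∀ᶠ n : ℕ in atTop, 2 ^ (s * n) ≤ ((bigCubes ν r α n).card : ℝ)) :
    ((s / α : ℝ) : EReal) ≤ lowerF ν r := by
  refine le_iSup₂_of_le α hα ?_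
  rw [EReal.coe_div]
  exact EReal.div_le_div_right_of_nonneg (EReal.coe_nonneg.2 hα.le)
    (le_liminf_coarseRatio hν hd hr h)

/-- Chernoff's trick in both tails: masses below x are compared with the moment of order p - h,
masses above y with that of order p + h, and only the window between remains. -/
theorem rpow_le_add_add_ite {m x y p h : ℝ} (hm : 0 < m) (hx : 0 < x) (hy : 0 < y) (hh : 0 ≤ h)
    (hp : 0 ≤ p) :
    m ^ p ≤ x ^ h * m ^ (p - h) + y ^ (-h) * m ^ (p + h) + if x ≤ m then y ^ p else 0 := by
  have h1 : 0 ≤ x ^ h * m ^ (p - h) := by positivity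
  have h2 : 0 ≤ y ^ (-h) * m ^ (p + h) := by positivity
  split_ifs with hxm
  · rcases le_total m y with hmy | hmy
    · linarith [Real.rpow_le_rpow hm.le hmy hp]
    · have : m ^ p ≤ y ^ (-h) * m ^ (p + h) := by
        calc m ^ p = m ^ (-h) * m ^ (p + h) := by rw [← Real.rpow_add hm]; ring_nf
          _ ≤ _ := by
            gcongr ?_ * _
            exact Real.rpow_le_rpow_of_nonpos hy hmy (by linarith)
      linarith [Real.rpow_nonneg hy.le p]
  · have : m ^ p ≤ x ^ h * m ^ (p - h) := by
      calc m ^ p = m ^ h * m ^ (p - h) := by rw [← Real.rpow_add hm]; ring_nf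
        _ ≤ _ := by
          gcongr ?_ * _
          exact Real.rpow_le_rpow hm.le (not_le.1 hxm).le hh
    linarith

/-- The hypotheses say that β stays within εh of a line of slope -a at q ± h. Both tails outside the
mass window 2^{-(a±2ε)n} are then exponentially smaller than the whole q-th moment, so the window
carries it; each cube there contributes at most y^q. -/
theorem eventually_le_card_of_beta_lt (hν : IsCompact ν.support) {q h a ε B : ℝ}
    (hq : 0 < q) (hh : 0 < h) (hε : 0 < ε) (hB : (B : EReal) ≤ betaLower ν q)
    (h1 : beta ν (q - h) < ((B + a * h + ε * h : ℝ) : EReal))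
    (h2 : beta ν (q + h) < ((B - a * h + ε * h : ℝ) : EReal)) :
    ∀ᶠ n : ℕ in atTop,
      2 ^ ((B - ε * h + (a - 2 * ε) * q) * n) ≤
        ((bigCubes ν r (r + a + 2 * ε) n).card : ℝ) := by
  have hεh : 0 < ε * h := mul_pos hε hh
  have hB' : ((B - ε * h / 2 : ℝ) : EReal) < betaLower ν q :=
    lt_of_lt_of_le (EReal.coe_lt_coe_iff.2 (by linarith)) hB
  filter_upwards [eventually_momentSum_le hν h1, eventually_momentSum_le hν h2,
    eventually_le_momentSum hν hB', eventually_le_two_rpow 4 (half_pos hεh)] with n e1 e2 e3 e4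
  -- Widening by 2ε gains 2εh in each tail exponent; one εh pays for the error in β, the other
  -- leaves both tails below D. The total is at least 4D.
  set x : ℝ := 2 ^ (-((a + 2 * ε) * n)) with hx
  set y : ℝ := 2 ^ (-((a - 2 * ε) * n)) with hy
  have hbig : (chargedCubes ν n).filter (fun k => x ≤ ν.real (cube d n k)) =
      bigCubes ν r (r + a + 2 * ε) n := by
    refine Finset.filter_congr fun k _ => ?_
    have : (2 : ℝ) ^ (-((r + a + 2 * ε) * n)) = x * 2 ^ (-(n * r)) := by
      rw [hx, ← Real.rpow_add (by norm_num)]; congr 1; ring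
    rw [this, mul_le_mul_iff_left₀ (by positivity)]
  have hsum : momentSum ν n q ≤ x ^ h * momentSum ν n (q - h) + y ^ (-h) * momentSum ν n (q + h)
      + (bigCubes ν r (r + a + 2 * ε) n).card * y ^ q := by
    calc momentSum ν n q ≤ ∑ k ∈ chargedCubes ν n, (x ^ h * ν.real (cube d n k) ^ (q - h) +
          y ^ (-h) * ν.real (cube d n k) ^ (q + h) +
          if x ≤ ν.real (cube d n k) then y ^ q else 0) :=
          Finset.sum_le_sum fun k hk => rpow_le_add_add_ite (mass_pos hν hk) (by positivity)
            (by positivity) hh.le hq.le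
      _ = _ := by
        rw [Finset.sum_add_distrib, Finset.sum_add_distrib, ← Finset.mul_sum, ← Finset.mul_sum,
          ← Finset.sum_filter, Finset.sum_const, nsmul_eq_mul, hbig]
        rfl
  set D : ℝ := 2 ^ ((B - ε * h) * n) with hD
  set W : ℝ := 2 ^ (ε * h / 2 * n) with hW
  have t1 : x ^ h * momentSum ν n (q - h) ≤ D := by
    calc x ^ h * momentSum ν n (q - h) ≤ x ^ h * 2 ^ ((B + a * h + ε * h) * n) := by gcongr
      _ = D := by
        rw [hx, hD, ← Real.rpow_mul (by norm_num), ← Real.rpow_add (by norm_num)]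
        congr 1; ring
  have t2 : y ^ (-h) * momentSum ν n (q + h) ≤ D := by
    calc y ^ (-h) * momentSum ν n (q + h) ≤ y ^ (-h) * 2 ^ ((B - a * h + ε * h) * n) := by gcongr
      _ = D := by
        rw [hy, hD, ← Real.rpow_mul (by norm_num), ← Real.rpow_add (by norm_num)]
        congr 1; ring
  have t3 : (2 : ℝ) ^ ((B - ε * h / 2) * n) = D * W := by
    rw [hW, hD, ← Real.rpow_add (by norm_num)]; congr 1; ring
  have t4 : (2 : ℝ) ^ ((B - ε * h + (a - 2 * ε) * q) * n) * y ^ q = D := by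
    rw [hy, hD, ← Real.rpow_mul (by norm_num), ← Real.rpow_add (by norm_num)]
    congr 1; ring
  have hD0 : 0 < D := by positivity
  have hy0 : 0 < y ^ q := by positivity
  refine le_of_mul_le_mul_right ?_ hy0
  rw [t4]
  nlinarith

theorem le_lowerF_of_differentiableAt (hν : IsCompact ν.support) (hd : 0 < d) (hr : 0 < r)
    {q : ℝ} (hq0 : 0 < q) (hq1 : q < 1) (hreg : beta ν q = betaLower ν q)
    (hrq : r * q ≤ betaReal ν q) (hdiff : DifferentiableAt ℝ (betaReal ν) q) :
    (q : EReal) ≤ lowerF ν r := by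
  set B := betaReal ν q with hBdef
  set a := -deriv (betaReal ν) q with ha
  have hder : HasDerivAt (betaReal ν) (-a) q := by simpa [ha] using hdiff.hasDerivAt
  have hlow : ∀ ε > 0, ε < 1 → ∃ h, 0 < h ∧ h < 1 ∧ 0 < q - h ∧ q + h < 1 ∧
      betaReal ν (q - h) < B + a * h + ε * h ∧ betaReal ν (q + h) < B - a * h + ε * h := by
    intro ε hε hε1
    have ho := hder.isLittleO.def (half_pos hε)
    obtain ⟨δ, hδ, hball⟩ := Metric.eventually_nhds_iff.1 ho
    obtain ⟨h, hh0, hh⟩ := exists_between (lt_min (lt_min hδ one_pos)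
      (lt_min hq0 (sub_pos.2 hq1)))
    simp only [lt_min_iff] at hh
    refine ⟨h, hh0, hh.1.2, by linarith [hh.2.1], by linarith [hh.2.2], ?_, ?_⟩
    · have := hball (y := q - h) (by simpa [abs_of_pos hh0] using hh.1.1)
      simp only [sub_sub_cancel_left, smul_eq_mul, Real.norm_eq_abs, abs_neg, abs_of_pos hh0]
        at this
      have := (abs_le.1 this).2
      nlinarith
    · have := hball (y := q + h) (by simpa [abs_of_pos hh0] using hh.1.1)
      simp only [add_sub_cancel_left, smul_eq_mul, Real.norm_eq_abs, abs_of_pos hh0]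
        at this
      have := (abs_le.1 this).2
      nlinarith
  -- β is nonincreasing; this keeps the level α = r + a + 2ε positive.
  have ha0 : 0 ≤ a := by
    have : derivWithin (betaReal ν) (Ioo 0 1) q ≤ 0 :=
      ((betaReal_antitoneOn hν).mono Ioo_subset_Ioc_self).derivWithin_nonpos
    rw [derivWithin_of_isOpen isOpen_Ioo ⟨hq0, hq1⟩] at this
    linarith
  have key : ∀ ε > 0, ε < 1 →
      (((q * (r + a) - 3 * ε) / (r + a + 2 * ε) : ℝ) : EReal) ≤ lowerF ν r := by
    intro ε hε hε1
    obtain ⟨h, hh0, hh1, hqh, hqh', h1, h2⟩ := hlow ε hε hε1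
    have hα : 0 < r + a + 2 * ε := by positivity
    refine le_trans ?_ (le_lowerF_of_eventually hν hd hr hα
      (eventually_le_card_of_beta_lt (B := B) (a := a) (ε := ε) hν hq0 hh0 hε ?_ ?_ ?_))
    -- Uses B ≥ rq; the loss εh + 2εq is below 3ε because h and q are less than 1.
    · rw [EReal.coe_le_coe_iff]
      gcongr
      nlinarith
    · rw [← hreg, hBdef, coe_betaReal hν hq0 hq1.le]
    · rw [← coe_betaReal hν hqh (by linarith), EReal.coe_lt_coe_iff]; exact h1
    · rw [← coe_betaReal hν (by linarith) hqh'.le, EReal.coe_lt_coe_iff]; exact h2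
  have hlim : Tendsto (fun ε : ℝ => (((q * (r + a) - 3 * ε) / (r + a + 2 * ε) : ℝ) : EReal))
      (𝓝[>] 0) (𝓝 (q : EReal)) := by
    refine (continuous_coe_real_ereal.tendsto q).comp (Tendsto.mono_left ?_ nhdsWithin_le_nhds)
    have hne : r + a + 2 * 0 ≠ 0 := by positivity
    have : ContinuousAt (fun ε : ℝ => (q * (r + a) - 3 * ε) / (r + a + 2 * ε)) 0 := by
      fun_prop (disch := exact hne)
    have hval : (q * (r + a) - 3 * 0) / (r + a + 2 * 0) = q := by
      have : r + a ≠ 0 := by positivity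
      field_simp; ring
    rw [ContinuousAt, hval] at this
    exact this
  refine le_of_tendsto hlim ?_
  filter_upwards [Ioo_mem_nhdsGT (zero_lt_one (α := ℝ))] with ε hε
  exact key ε hε.1 hε.2

/-- Lebesgue's theorem on monotone functions: β is differentiable almost everywhere on the interval.
-/
theorem exists_differentiableAt_betaReal (hν : IsCompact ν.support) {u v : ℝ} (hu : 0 ≤ u)
    (huv : u < v) (hv : v ≤ 1) : ∃ q ∈ Ioo u v, DifferentiableAt ℝ (betaReal ν) q := by
  have hsub : Ioo u v ⊆ Ioc 0 1 := fun x hx => ⟨hu.trans_lt hx.1, hx.2.le.trans hv⟩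
  have hmono : MonotoneOn (fun q => -betaReal ν q) (Ioo u v) :=
    ((betaReal_antitoneOn hν).mono hsub).neg
  have hae := hmono.ae_differentiableWithinAt measurableSet_Ioo
  have : (ae (volume.restrict (Ioo u v))).NeBot := by
    rw [ae_neBot, Ne, Measure.restrict_eq_zero, Real.volume_Ioo]
    simpa using huv
  obtain ⟨q, hq, hqm⟩ := (hae.and (ae_restrict_mem measurableSet_Ioo)).exists
  refine ⟨q, hqm, ?_⟩
  have := (hq.differentiableAt (isOpen_Ioo.mem_nhds hqm)).neg
  simpa using this

theorem critExp_le_lowerF (hν : IsCompact ν.support) (hd : 0 < d) (hr : 0 < r)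
    (hreg : LqRegular ν r) : critExp ν r ≤ lowerF ν r := by
  have h1 := critExp_lt_one (r := r) hν hr
  rcases (critExp_nonneg (ν := ν) (r := r)).eq_or_lt with h0 | h0
  · rw [← h0]; exact lowerF_nonneg
  rcases hreg with ⟨ε, hε, hreg⟩ | ⟨hreg, g, hg, hdiff⟩
  -- Alternative (a): a differentiability point q in the regularity window, above p and below c,
  -- satisfies β(q) ≥ rq.
  · refine EReal.ge_of_forall_gt_iff_ge.1 fun p hp => ?_
    rw [EReal.coe_lt_coe_iff] at hp
    have hlt : max (max p 0) (critExp ν r - ε) < critExp ν r :=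
      max_lt (max_lt hp h0) (by linarith)
    obtain ⟨q, hq, hqd⟩ := exists_differentiableAt_betaReal hν
      ((le_max_right p 0).trans (le_max_left _ (critExp ν r - ε))) hlt h1.le
    have hq' := hq.1
    simp only [max_lt_iff] at hq'
    refine le_trans (EReal.coe_le_coe_iff.2 hq'.1.1.le) (le_lowerF_of_differentiableAt hν hd hr
      hq'.1.2 (hq.2.trans h1) (hreg q ⟨hq'.2, hq.2⟩ hq'.1.2.le).1 ?_ hqd)
    rw [← EReal.coe_le_coe_iff, coe_betaReal hν hq'.1.2 (hq.2.trans h1).le]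
    exact le_beta_of_lt_critExp hq'.1.2 hq.2
  -- Alternative (b): q = c itself works, since β(c) = rc and c is interior to [0, ∞).
  · refine le_lowerF_of_differentiableAt hν hd hr h0 h1 hreg ?_ ?_
    · rw [← EReal.coe_le_coe_iff, coe_betaReal hν h0 h1.le, beta_critExp hν hr h0]
    · refine (hdiff.differentiableAt (Ici_mem_nhds h0)).congr_of_eventuallyEq ?_
      filter_upwards [Ici_mem_nhds h0] with q hq
      rw [betaReal, hg q hq, EReal.toReal_coe]

theorem MFRegular_of_LqRegular (hν : IsCompact ν.support) (hd : 0 < d) (hr : 0 < r)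
    (hreg : LqRegular ν r) : MFRegular ν r :=
  le_antisymm lowerF_le_upperF
    ((upperF_le_critExp hν hd hr).trans (critExp_le_lowerF hν hd hr hreg))

end

/-! ### Upper bound for the quantization dimension by adaptive dyadic covers. -/

section

variable {d : ℕ} {ν : Measure (EuclideanSpace ℝ (Fin d))} {r : ℝ}

/-- A finite cover by small sets gives a quantizer. -/
theorem quantError_le_of_cover {ι : Type*} (hr : 0 < r) {P : Finset ι} (hP : P.Nonempty) {N : ℕ}
    (hN : P.card ≤ N) {U : ι → Set (EuclideanSpace ℝ (Fin d))} (hU : ∀ i, MeasurableSet (U i))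
    (c : ι → EuclideanSpace ℝ (Fin d)) {ρ : ι → ℝ≥0∞}
    (hcover : ∀ᵐ x ∂ν, ∃ i ∈ P, x ∈ U i) (hρ : ∀ i ∈ P, ∀ x ∈ U i, ‖x - c i‖ₑ ≤ ρ i) :
    quantError ν r N ≤ (∑ i ∈ P, ρ i ^ r * ν (U i)) ^ (1 / r) := by
  set e : ℕ → EuclideanSpace ℝ (Fin d) := fun j =>
    if h : j < P.card then c (P.equivFin.symm ⟨j, h⟩) else 0 with he
  have hcard : 0 < P.card := hP.card_pos
  -- `nearestPt e N` chooses among the N + 1 points e 0, …, e N, hence the subtraction of one.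
  set f := SimpleFunc.nearestPt e (P.card - 1) with hf
  have hrange : (range f).encard ≤ N := by
    have hsub : range f ⊆ ((Finset.range P.card).image e : Finset _) := by
      rintro _ ⟨x, rfl⟩
      rw [Finset.coe_image]
      refine ⟨SimpleFunc.nearestPtInd e (P.card - 1) x, ?_, rfl⟩
      have := SimpleFunc.nearestPtInd_le e (P.card - 1) x
      rw [Finset.coe_range, mem_Iio]
      omega
    refine (encard_le_encard hsub).trans ?_
    rw [encard_coe_eq_coe_finsetCard]
    have := Finset.card_image_le (s := Finset.range P.card) (f := e)
    rw [Finset.card_range] at this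
    exact_mod_cast this.trans hN
  refine (iInf₂_le (⇑f) ⟨f.measurable, hrange⟩).trans ?_
  refine ENNReal.rpow_le_rpow ?_ (by positivity)
  calc ∫⁻ x, ‖x - f x‖ₑ ^ r ∂ν
      ≤ ∫⁻ x, ∑ i ∈ P, (U i).indicator (fun _ => ρ i ^ r) x ∂ν := by
        refine lintegral_mono_ae ?_
        filter_upwards [hcover] with x hx
        obtain ⟨i, hi, hxi⟩ := hx
        refine le_trans ?_ (Finset.single_le_sum (f := fun i => (U i).indicator
          (fun _ => ρ i ^ r) x) (fun _ _ => zero_le) hi)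
        rw [indicator_of_mem hxi]
        refine ENNReal.rpow_le_rpow ?_ hr.le
        refine le_trans ?_ (hρ i hi x hxi)
        have hj := (P.equivFin ⟨i, hi⟩).2
        have := SimpleFunc.edist_nearestPt_le e x (k := P.equivFin ⟨i, hi⟩) (N := P.card - 1)
          (by omega)
        have hek : e (P.equivFin ⟨i, hi⟩) = c i := by simp [he]
        rw [hek, edist_comm, edist_comm (c i)] at this
        simpa only [edist_eq_enorm_sub] using this
    _ = ∑ i ∈ P, ρ i ^ r * ν (U i) := by
        rw [lintegral_finsetSum _ fun i _ => measurable_const.indicator (hU i)]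
        refine Finset.sum_congr rfl fun i _ => ?_
        rw [lintegral_indicator_const (hU i)]

/-- For b > 1/κ the slack (κ - 1/b) log N eventually absorbs log K. -/
theorem upperQuantDim_le {K κ : ℝ} (hK : 0 < K) (hκ : 0 < κ)
    (h : ∀ᶠ N : ℕ in atTop, quantError ν r N ≤ ENNReal.ofReal (K * (N : ℝ) ^ (-κ))) :
    upperQuantDim ν r ≤ ((1 / κ : ℝ) : EReal) := by
  refine EReal.le_of_forall_lt_iff_le.1 fun b hb => ?_
  rw [EReal.coe_lt_coe_iff] at hb
  have hb0 : 0 < b := lt_trans (by positivity) hb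
  have hgap : 0 < κ - 1 / b := by
    rw [div_lt_iff₀ hκ] at hb
    rw [sub_pos, div_lt_iff₀ hb0]; linarith
  have hlog := (Real.tendsto_log_atTop.comp tendsto_natCast_atTop_atTop).eventually_ge_atTop
    (Real.log K / (κ - 1 / b))
  refine limsup_le_of_le (by isBoundedDefault) ?_
  filter_upwards [h, hlog, eventually_gt_atTop 1] with N hN hlogN hN1
  have hN1' : (1 : ℝ) < N := by exact_mod_cast hN1
  have hlogpos : 0 < Real.log N := Real.log_pos hN1'
  have hNpos : (0 : ℝ) < N := by linarith
  rw [Function.comp_apply, div_le_iff₀ hgap] at hlogN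
  have h1 : ENNReal.log (quantError ν r N) ≤ ((-(1 / b * Real.log N) : ℝ) : EReal) := by
    refine (ENNReal.log_le_log hN).trans ?_
    rw [ENNReal.log_ofReal_of_pos (by positivity), EReal.coe_le_coe_iff,
      Real.log_mul hK.ne' (by positivity), Real.log_rpow hNpos]
    linarith
  have h2 : ((1 / b * Real.log N : ℝ) : EReal) ≤ -ENNReal.log (quantError ν r N) := by
    rw [EReal.le_neg, ← EReal.coe_neg]; exact h1
  generalize -ENNReal.log (quantError ν r N) = y at h2
  induction y with
  | bot => exact absurd (le_bot_iff.1 h2) (EReal.coe_ne_bot _)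
  | top => rw [EReal.div_top]; exact EReal.coe_nonneg.2 hb0.le
  | coe y =>
    rw [EReal.coe_le_coe_iff] at h2
    have hy : 0 < y := lt_of_lt_of_le (by positivity) h2
    rw [← EReal.coe_div, EReal.coe_le_coe_iff, div_le_iff₀ hy]
    calc Real.log N = b * (1 / b * Real.log N) := by field_simp
      _ ≤ b * y := by gcongr

theorem lowerQuantDim_nonneg (h1 : ∀ᶠ N : ℕ in atTop, quantError ν r N < 1) :
    0 ≤ lowerQuantDim ν r := by
  refine le_liminf_of_le (by isBoundedDefault) ?_
  filter_upwards [h1] with N hN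
  refine EReal.div_nonneg (EReal.coe_nonneg.2 (Real.log_natCast_nonneg N)) ?_
  rw [EReal.le_neg, neg_zero, ENNReal.log_le_zero_iff]
  exact hN.le

/-- Errors below 1 make the denominator positive, and the lower bound on the error makes it finite,
so the quotient is a genuine real one. -/
theorem le_lowerQuantDim {c κ : ℝ} (hc : 0 < c) (hκ : 0 < κ)
    (h1 : ∀ᶠ N : ℕ in atTop, quantError ν r N < 1)
    (h : ∀ᶠ N : ℕ in atTop, ENNReal.ofReal (c * (N : ℝ) ^ (-κ)) ≤ quantError ν r N) :
    ((1 / κ : ℝ) : EReal) ≤ lowerQuantDim ν r := by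
  refine EReal.ge_of_forall_gt_iff_ge.1 fun b hb => ?_
  rw [EReal.coe_lt_coe_iff] at hb
  rcases le_or_gt b 0 with hb0 | hb0
  · exact le_trans (EReal.coe_nonpos.2 hb0) (lowerQuantDim_nonneg h1)
  have hgap : 0 < 1 / b - κ := by
    rw [lt_div_iff₀ hκ] at hb
    rw [sub_pos, lt_div_iff₀ hb0]; linarith
  have hlog := (Real.tendsto_log_atTop.comp tendsto_natCast_atTop_atTop).eventually_ge_atTop
    (-Real.log c / (1 / b - κ))
  refine le_liminf_of_le (by isBoundedDefault) ?_
  filter_upwards [h, h1, hlog, eventually_gt_atTop 1] with N hN hN' hlogN hN1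
  have hN1' : (1 : ℝ) < N := by exact_mod_cast hN1
  have hNpos : (0 : ℝ) < N := by linarith
  rw [Function.comp_apply, div_le_iff₀ hgap] at hlogN
  have h2 : -ENNReal.log (quantError ν r N) ≤ ((1 / b * Real.log N : ℝ) : EReal) := by
    rw [EReal.neg_le, ← EReal.coe_neg]
    refine le_trans ?_ (ENNReal.log_le_log hN)
    rw [ENNReal.log_ofReal_of_pos (by positivity), EReal.coe_le_coe_iff,
      Real.log_mul hc.ne' (by positivity), Real.log_rpow hNpos]
    linarith
  have h3 : 0 < -ENNReal.log (quantError ν r N) := by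
    rw [EReal.lt_neg_comm, neg_zero, ENNReal.log_lt_zero_iff]; exact hN'
  generalize -ENNReal.log (quantError ν r N) = y at h2 h3
  induction y with
  | bot => exact absurd h3 (by simp)
  | top => exact absurd (top_le_iff.1 h2) (EReal.coe_ne_top _)
  | coe y =>
    rw [EReal.coe_le_coe_iff] at h2
    have hy : 0 < y := EReal.coe_pos.1 h3
    rw [← EReal.coe_div, EReal.coe_le_coe_iff, le_div_iff₀ hy]
    calc b * y ≤ b * (1 / b * Real.log N) := by gcongr
      _ = Real.log N := by field_simp

variable [IsProbabilityMeasure ν]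

theorem summable_momentSum (hν : IsCompact ν.support) {q : ℝ}
    (hq : beta ν q < ((r * q : ℝ) : EReal)) :
    Summable fun n : ℕ => momentSum ν n q * 2 ^ (-(r * q * n)) := by
  obtain ⟨b, hb, hbq⟩ := EReal.lt_iff_exists_real_btwn.1 hq
  rw [EReal.coe_lt_coe_iff] at hbq
  have hgeom : Summable fun n : ℕ => ((2 : ℝ) ^ (b - r * q)) ^ n :=
    summable_geometric_of_lt_one (by positivity)
      (Real.rpow_lt_one_of_one_lt_of_neg (by norm_num) (by linarith))
  refine summable_of_isBigO_nat hgeom (Asymptotics.IsBigO.of_bound 1 ?_)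
  filter_upwards [eventually_momentSum_le hν hb] with n hn
  have h0 := momentSum_pos hν n q
  rw [Real.norm_of_nonneg (by positivity), Real.norm_of_nonneg (by positivity), one_mul]
  calc momentSum ν n q * 2 ^ (-(r * q * n)) ≤ 2 ^ (b * n) * 2 ^ (-(r * q * n)) := by gcongr
    _ = _ := by
      rw [← Real.rpow_add (by norm_num), ← Real.rpow_natCast, ← Real.rpow_mul (by norm_num)]
      congr 1; ring

/-- Stopping at the first dyadic cube `Q` with `ν(Q) Λ(Q)^{r/d} < t` yields a cover. -/
theorem exists_dyadic_cover (hν : IsCompact ν.support) (hr : 0 < r) {q : ℝ} (hq0 : 0 < q)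
    (hq : beta ν q < ((r * q : ℝ) : EReal)) :
    ∃ A : ℝ, 0 < A ∧ ∀ t : ℝ, 0 < t → t ≤ 1 → ∃ P : Finset (ℕ × (Fin d → ℤ)),
      (P.card : ℝ) ≤ A * t ^ (-q) ∧ (∀ᵐ x ∂ν, ∃ p ∈ P, x ∈ cube d p.1 p.2) ∧
      ∀ p ∈ P, ν.real (cube d p.1 p.2) * 2 ^ (-(p.1 * r)) ≤ t := by
  have hsum := summable_momentSum hν hq
  set S := ∑' n : ℕ, momentSum ν n q * 2 ^ (-(r * q * n)) with hS
  have hS0 : 0 ≤ S := tsum_nonneg fun n => mul_nonneg (momentSum_pos hν n q).le (by positivity)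
  refine ⟨(chargedCubes ν 0).card + 2 ^ d * S + 1, by positivity, fun t ht ht1 => ?_⟩
  -- At level m the volume factor alone is below t, so every point stops by then.
  obtain ⟨m, hm⟩ := (eventually_le_two_rpow (t⁻¹ + 1) hr).exists
  have hmt : (2 : ℝ) ^ (-(m * r)) < t := by
    rw [Real.rpow_neg (by norm_num), inv_lt_comm₀ (by positivity) ht, mul_comm]
    linarith
  set J : ℕ → (Fin d → ℤ) → ℝ := fun n k => ν.real (cube d n k) * 2 ^ (-(n * r)) with hJ
  set bad : ℕ → Finset (Fin d → ℤ) := fun n => (chargedCubes ν n).filter fun k => t ≤ J n k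
    with hbad
  -- A stopping cube is at level 0 or is one of the 2^d children of a cube with J ≥ t. Markov's
  -- inequality, summed over all levels, bounds the number of such parents by t^{-q} S.
  set P₀ : Finset (ℕ × (Fin d → ℤ)) := (chargedCubes ν 0).image (fun k => (0, k)) ∪
    (Finset.range m).biUnion fun n => (bad n ×ˢ (Finset.univ : Finset (Fin d → Fin 2))).image
      fun p => (n + 1, childIndex p.1 p.2) with hP₀
  refine ⟨P₀.filter fun p => J p.1 p.2 ≤ t, ?_, ?_, fun p hp => (Finset.mem_filter.1 hp).2⟩
  · have hcard : (P₀.card : ℝ) ≤ (chargedCubes ν 0).card +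
        ∑ n ∈ Finset.range m, ((bad n).card : ℝ) * 2 ^ d := by
      have : P₀.card ≤ (chargedCubes ν 0).card + ∑ n ∈ Finset.range m, (bad n).card * 2 ^ d := by
        refine (Finset.card_union_le _ _).trans (add_le_add Finset.card_image_le
          (Finset.card_biUnion_le.trans (Finset.sum_le_sum fun n _ => ?_)))
        refine Finset.card_image_le.trans ?_
        rw [Finset.card_product]; simp
      exact_mod_cast this
    have hts : (1 : ℝ) ≤ t ^ (-q) := Real.one_le_rpow_of_pos_of_le_one_of_nonpos ht ht1 (by linarith)
    have hbadsum : ∑ n ∈ Finset.range m, ((bad n).card : ℝ) * 2 ^ d ≤ 2 ^ d * (t ^ (-q) * S) := by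
      rw [← Finset.sum_mul, mul_comm]
      gcongr
      calc ∑ n ∈ Finset.range m, ((bad n).card : ℝ)
          ≤ ∑ n ∈ Finset.range m, t ^ (-q) * (momentSum ν n q * 2 ^ (-(r * q * n))) :=
            Finset.sum_le_sum fun n _ => card_filter_le n ht hq0
        _ ≤ t ^ (-q) * S := by
            rw [← Finset.mul_sum]
            gcongr
            exact hsum.sum_le_tsum _
              fun n _ => mul_nonneg (momentSum_pos hν n q).le (by positivity)
    calc ((P₀.filter fun p => J p.1 p.2 ≤ t).card : ℝ) ≤ P₀.card := by
          exact_mod_cast Finset.card_filter_le _ _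
      _ ≤ (chargedCubes ν 0).card + 2 ^ d * (t ^ (-q) * S) := by linarith
      _ ≤ (chargedCubes ν 0).card * t ^ (-q) + 2 ^ d * (t ^ (-q) * S) + t ^ (-q) := by
          have : ((chargedCubes ν 0).card : ℝ) ≤ (chargedCubes ν 0).card * t ^ (-q) :=
            le_mul_of_one_le_right (by positivity) hts
          linarith
      _ = _ := by ring
  · filter_upwards [ae_mem_chargedCubes hν] with x hx
    have hex : ∃ n, J n (cubeIndex n x) < t := by
      refine ⟨m, lt_of_le_of_lt ?_ hmt⟩
      calc J m (cubeIndex m x) ≤ 1 * 2 ^ (-(m * r)) := by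
            simp only [hJ]; gcongr; exact measureReal_le_one
        _ = _ := one_mul _
    classical
    set n := Nat.find hex with hn
    have hnspec : J n (cubeIndex n x) < t := Nat.find_spec hex
    have hnm : n ≤ m := Nat.find_min' hex (by
      refine lt_of_le_of_lt ?_ hmt
      calc J m (cubeIndex m x) ≤ 1 * 2 ^ (-(m * r)) := by
            simp only [hJ]; gcongr; exact measureReal_le_one
        _ = _ := one_mul _)
    refine ⟨(n, cubeIndex n x), Finset.mem_filter.2 ⟨?_, hnspec.le⟩, mem_cube_cubeIndex n x⟩
    rcases hcase : n with _ | l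
    · exact Finset.mem_union_left _ (Finset.mem_image_of_mem _ (hx 0))
    · refine Finset.mem_union_right _ (Finset.mem_biUnion.2 ⟨l, ?_, ?_⟩)
      · rw [Finset.mem_range]; omega
      · obtain ⟨e, he⟩ := exists_childIndex l x
        refine Finset.mem_image.2 ⟨(cubeIndex l x, e), ?_, by rw [he]⟩
        refine Finset.mem_product.2 ⟨Finset.mem_filter.2 ⟨hx l, ?_⟩, Finset.mem_univ _⟩
        exact not_lt.1 (Nat.find_min hex (by omega))

/-- With a corner as code point, a cube of side 2^{-n} contributes at most (d·2^{-n})^r ν(Q) ≤ d^r t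
to the r-th power of the error. -/
theorem quantError_le_of_dyadic_cover (hr : 0 < r) {P : Finset (ℕ × (Fin d → ℤ))}
    (hcover : ∀ᵐ x ∂ν, ∃ p ∈ P, x ∈ cube d p.1 p.2) {t : ℝ} (ht : 0 < t)
    (hP : ∀ p ∈ P, ν.real (cube d p.1 p.2) * 2 ^ (-(p.1 * r)) ≤ t) {N : ℕ} (hN : P.card ≤ N) :
    quantError ν r N ≤ ENNReal.ofReal ((N * ((d : ℝ) ^ r * t)) ^ (1 / r)) := by
  have hne : P.Nonempty := by
    obtain ⟨x, p, hp, -⟩ := hcover.exists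
    exact ⟨p, hp⟩
  refine (quantError_le_of_cover hr hne hN (U := fun p => cube d p.1 p.2)
    (ρ := fun p => ENNReal.ofReal (d * (2 : ℝ) ^ (-(p.1 : ℝ)))) (fun p => measurableSet_cube _ _)
    (fun p => corner p.1 p.2) hcover fun p _ x hx => ?_).trans ?_
  · rw [← ofReal_norm]
    exact ENNReal.ofReal_le_ofReal (norm_sub_corner_le hx)
  · rw [← ENNReal.ofReal_rpow_of_nonneg (by positivity) (by positivity)]
    refine ENNReal.rpow_le_rpow ?_ (by positivity)
    calc ∑ p ∈ P, ENNReal.ofReal (d * (2 : ℝ) ^ (-(p.1 : ℝ))) ^ r * ν (cube d p.1 p.2)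
        ≤ ∑ p ∈ P, ENNReal.ofReal ((d : ℝ) ^ r * t) := by
          refine Finset.sum_le_sum fun p hp => ?_
          rw [← ofReal_measureReal (μ := ν) (measure_ne_top _ _),
            ENNReal.ofReal_rpow_of_nonneg (by positivity) hr.le,
            ← ENNReal.ofReal_mul (by positivity)]
          refine ENNReal.ofReal_le_ofReal ?_
          rw [Real.mul_rpow (by positivity) (by positivity), ← Real.rpow_mul (by norm_num),
            mul_assoc]
          gcongr
          have := hP p hp
          rwa [mul_comm, neg_mul]
      _ = ENNReal.ofReal (P.card * ((d : ℝ) ^ r * t)) := by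
          rw [Finset.sum_const, nsmul_eq_mul,
            ENNReal.ofReal_mul (p := (P.card : ℝ)) (by positivity), ENNReal.ofReal_natCast]
      _ ≤ _ := by
          refine ENNReal.ofReal_le_ofReal ?_
          gcongr

theorem eventually_quantError_le (hν : IsCompact ν.support) (hd : 0 < d) (hr : 0 < r) {q : ℝ}
    (hq0 : 0 < q) (hq : beta ν q < ((r * q : ℝ) : EReal)) :
    ∃ K : ℝ, 0 < K ∧ ∀ᶠ N : ℕ in atTop,
      quantError ν r N ≤ ENNReal.ofReal (K * (N : ℝ) ^ (-((1 - q) / (r * q)))) := by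
  obtain ⟨A, hA, hcov⟩ := exists_dyadic_cover hν hr hq0 hq
  refine ⟨((d : ℝ) ^ r * A ^ (1 / q)) ^ (1 / r), by positivity, ?_⟩
  filter_upwards [tendsto_natCast_atTop_atTop.eventually_ge_atTop (max A 1)] with N hN
  have hNA : A ≤ N := (le_max_left _ _).trans hN
  have hN0 : (0 : ℝ) < N := lt_of_lt_of_le hA hNA
  -- Solves A t^{-q} = N: the whole budget of N points is spent, and N·t is of order N^{1-1/q}.
  set t : ℝ := (N / A) ^ (-(1 / q)) with ht
  have ht0 : 0 < t := by positivity
  have ht1 : t ≤ 1 := Real.rpow_le_one_of_one_le_of_nonpos ((one_le_div hA).2 hNA)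
    (by rw [neg_nonpos]; positivity)
  obtain ⟨P, hcard, hcover, hP⟩ := hcov t ht0 ht1
  have hcardN : P.card ≤ N := by
    have : A * t ^ (-q) = N := by
      rw [ht, ← Real.rpow_mul (by positivity), neg_mul_neg, one_div_mul_cancel hq0.ne',
        Real.rpow_one, mul_div_cancel₀ _ hA.ne']
    rw [this] at hcard
    exact_mod_cast hcard
  refine (quantError_le_of_dyadic_cover hr hcover ht0 hP hcardN).trans
    (ENNReal.ofReal_le_ofReal (le_of_eq ?_))
  have h1 : (N : ℝ) * ((d : ℝ) ^ r * t) = ((d : ℝ) ^ r * A ^ (1 / q)) * N ^ (1 - 1 / q) := by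
    rw [ht, Real.div_rpow hN0.le hA.le, Real.rpow_neg hA.le (1 / q), div_inv_eq_mul,
      sub_eq_add_neg, Real.rpow_add hN0, Real.rpow_one]
    ring
  rw [h1, Real.mul_rpow (by positivity) (by positivity), ← Real.rpow_mul hN0.le]
  congr 2
  field_simp
  ring

theorem eventually_quantError_lt_one (hν : IsCompact ν.support) (hd : 0 < d) (hr : 0 < r) :
    ∀ᶠ N : ℕ in atTop, quantError ν r N < 1 := by
  obtain ⟨q, hq0, -, hq1, hq⟩ := exists_beta_lt hν hr (critExp_lt_one hν hr)
  obtain ⟨K, hK, hKN⟩ := eventually_quantError_le hν hd hr hq0 hq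
  have hκ : 0 < (1 - q) / (r * q) := div_pos (sub_pos.2 hq1) (by positivity)
  have hlim : Tendsto (fun N : ℕ => K * (N : ℝ) ^ (-((1 - q) / (r * q)))) atTop (𝓝 (K * 0)) :=
    ((tendsto_rpow_neg_atTop hκ).comp tendsto_natCast_atTop_atTop).const_mul K
  rw [mul_zero] at hlim
  filter_upwards [hKN, hlim.eventually_lt_const one_pos] with N h1 h2
  exact h1.trans_lt (by rw [ENNReal.ofReal_lt_one]; exact h2)

theorem upperQuantDim_le_of_beta_lt (hν : IsCompact ν.support) (hd : 0 < d) (hr : 0 < r) {q : ℝ}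
    (hq0 : 0 < q) (hq1 : q < 1) (hq : beta ν q < ((r * q : ℝ) : EReal)) :
    upperQuantDim ν r ≤ ((r * q / (1 - q) : ℝ) : EReal) := by
  obtain ⟨K, hK, hKN⟩ := eventually_quantError_le hν hd hr hq0 hq
  have := upperQuantDim_le hK (div_pos (sub_pos.2 hq1) (by positivity)) hKN
  rwa [one_div_div] at this

theorem upperQuantDim_le_critExp (hν : IsCompact ν.support) (hd : 0 < d) (hr : 0 < r) :
    upperQuantDim ν r ≤ ((r * critExp ν r / (1 - critExp ν r) : ℝ) : EReal) := by
  have h1 := critExp_lt_one (r := r) hν hr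
  set c := critExp ν r with hc
  have hlim : Tendsto (fun b : ℝ => ((r * b / (1 - b) : ℝ) : EReal)) (𝓝[>] c)
      (𝓝 ((r * c / (1 - c) : ℝ) : EReal)) := by
    refine (continuous_coe_real_ereal.tendsto _).comp (Tendsto.mono_left ?_ nhdsWithin_le_nhds)
    have hne : 1 - c ≠ 0 := (sub_pos.2 h1).ne'
    have : ContinuousAt (fun b : ℝ => r * b / (1 - b)) c := by fun_prop (disch := exact hne)
    exact this
  refine ge_of_tendsto hlim ?_
  filter_upwards [Ioo_mem_nhdsGT h1] with b hb
  obtain ⟨q, hq0, -, hqb, hq⟩ := exists_beta_lt hν hr hb.1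
  refine (upperQuantDim_le_of_beta_lt hν hd hr hq0 (hqb.trans hb.2) hq).trans
    (EReal.coe_le_coe_iff.2 ?_)
  have := sub_pos.2 hb.2
  have hb0 : 0 < b := hq0.trans hqb
  gcongr

end

/-! ### Lower bound for the quantization dimension by counting cubes. -/

section

variable {d : ℕ} {ν : Measure (EuclideanSpace ℝ (Fin d))} {r : ℝ}

theorem lowerQuantDim_le_upperQuantDim : lowerQuantDim ν r ≤ upperQuantDim ν r :=
  liminf_le_limsup (by isBoundedDefault) (by isBoundedDefault)

variable [IsProbabilityMeasure ν]

/-- If there are many cubes `Q` of level `n` with `ν(Q) Λ(Q)^{r/d} ≥ 2^{-αn}`, then most of them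
are at distance at least `2⁻ⁿ` from all values of a quantizer. -/
theorem le_quantError_of_card (hr : 0 < r) {α : ℝ} {n M : ℕ}
    (hM : 2 * 3 ^ d * M ≤ (bigCubes ν r α n).card) :
    ENNReal.ofReal ((1 / 2 * (bigCubes ν r α n).card * 2 ^ (-(α * n))) ^ (1 / r)) ≤
      quantError ν r M := by
  refine le_iInf₂ fun f hf => ?_
  rw [← ENNReal.ofReal_rpow_of_nonneg (by positivity) (by positivity)]
  refine ENNReal.rpow_le_rpow ?_ (by positivity)
  have hfin : (range f).Finite := Set.finite_of_encard_le_coe hf.2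
  set V := hfin.toFinset with hV
  have hVcard : V.card ≤ M := by
    have := hf.2
    rw [hfin.encard_eq_coe_toFinset_card] at this
    exact_mod_cast this
  -- All cubes that can meet the open 2^{-n}-ball around some value; by `hM` they make up at most
  -- half of the family.
  set hit : Finset (Fin d → ℤ) := V.biUnion fun a =>
    Fintype.piFinset fun i => Finset.Icc (cubeIndex n a i - 1) (cubeIndex n a i + 1) with hhit
  have hhitcard : hit.card ≤ M * 3 ^ d := by
    refine (Finset.card_biUnion_le_card_mul _ _ (3 ^ d) fun a _ => ?_).trans
      (Nat.mul_le_mul_right _ hVcard)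
    rw [Fintype.card_piFinset]
    refine le_of_eq ?_
    rw [Finset.prod_congr rfl (g := fun _ => 3) fun i _ => by rw [Int.card_Icc]; omega]
    simp
  set good := bigCubes ν r α n \ hit with hgood
  have hgoodcard : 1 / 2 * ((bigCubes ν r α n).card : ℝ) ≤ good.card := by
    have h1 : (bigCubes ν r α n).card ≤ good.card + hit.card := Finset.card_le_card_sdiff_add_card
    have h2 : (bigCubes ν r α n).card ≤ 2 * good.card := by nlinarith
    have h3 : ((bigCubes ν r α n).card : ℝ) ≤ 2 * good.card := by exact_mod_cast h2
    linarith
  have hfar : ∀ k ∈ good, ∀ x ∈ cube d n k, ENNReal.ofReal (2 ^ (-(n * r))) ≤ ‖x - f x‖ₑ ^ r := by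
    intro k hk x hx
    have h1 : (2 : ℝ) ^ (-(n : ℝ)) ≤ ‖x - f x‖ := by
      by_contra! hlt
      refine (Finset.mem_sdiff.1 hk).2 (Finset.mem_biUnion.2 ⟨f x, ?_, ?_⟩)
      · exact hfin.mem_toFinset.2 (mem_range_self x)
      · rw [Fintype.mem_piFinset, ← mem_cube_iff.1 hx]
        exact abs_cubeIndex_sub_le hlt
    calc ENNReal.ofReal (2 ^ (-(n * r))) = ENNReal.ofReal ((2 : ℝ) ^ (-(n : ℝ))) ^ r := by
          rw [ENNReal.ofReal_rpow_of_nonneg (by positivity) hr.le, ← Real.rpow_mul (by norm_num),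
            neg_mul]
      _ ≤ ‖x - f x‖ₑ ^ r := by
          rw [← ofReal_norm]
          exact ENNReal.rpow_le_rpow (ENNReal.ofReal_le_ofReal h1) hr.le
  calc ENNReal.ofReal (1 / 2 * (bigCubes ν r α n).card * 2 ^ (-(α * n)))
      ≤ ENNReal.ofReal (good.card * 2 ^ (-(α * n))) := by gcongr
    _ = ∑ k ∈ good, ENNReal.ofReal (2 ^ (-(α * n))) := by
        rw [Finset.sum_const, nsmul_eq_mul, ENNReal.ofReal_mul (by positivity),
          ENNReal.ofReal_natCast]
    _ ≤ ∑ k ∈ good, ∫⁻ x in cube d n k, ‖x - f x‖ₑ ^ r ∂ν := by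
        refine Finset.sum_le_sum fun k hk => ?_
        have hbig := (Finset.mem_filter.1 (Finset.mem_sdiff.1 hk).1).2
        calc ENNReal.ofReal (2 ^ (-(α * n)))
            ≤ ENNReal.ofReal (2 ^ (-(n * r)) * ν.real (cube d n k)) :=
              ENNReal.ofReal_le_ofReal (by rw [mul_comm (2 ^ (-(n * r)) : ℝ)]; exact hbig)
          _ = ENNReal.ofReal (2 ^ (-(n * r))) * ν (cube d n k) := by
              rw [ENNReal.ofReal_mul (by positivity), ofReal_measureReal (measure_ne_top _ _)]
          _ = ∫⁻ x in cube d n k, ENNReal.ofReal (2 ^ (-(n * r))) ∂ν := by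
              rw [setLIntegral_const]
          _ ≤ _ := setLIntegral_mono' (measurableSet_cube n k) (hfar k hk)
    _ = ∫⁻ x in ⋃ k ∈ good, cube d n k, ‖x - f x‖ₑ ^ r ∂ν :=
        (lintegral_biUnion_finset ((pairwise_disjoint_cube n).set_pairwise _)
          (fun k _ => measurableSet_cube n k) _).symm
    _ ≤ ∫⁻ x, ‖x - f x‖ₑ ^ r ∂ν := setLIntegral_le_lintegral _ _

/-- Given M, take the first level n with 2^{σn} ≥ LM. The r-th power of the error is then at least
2^{(σ-α)n}/2, and 2^n is M^{1/σ} up to a constant; rounding n up costs only the factor 2^σ. -/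
theorem eventually_le_quantError (hr : 0 < r) {α σ : ℝ} (hσ : 0 < σ) (hσα : σ < α)
    (h : ∀ᶠ n : ℕ in atTop, 2 ^ (σ * n) ≤ ((bigCubes ν r α n).card : ℝ)) :
    ∃ c : ℝ, 0 < c ∧ ∀ᶠ M : ℕ in atTop,
      ENNReal.ofReal (c * (M : ℝ) ^ (-((α - σ) / (σ * r)))) ≤ quantError ν r M := by
  set L : ℝ := 2 * 3 ^ d with hL
  have hL0 : 0 < L := by positivity
  refine ⟨(1 / 2 * (2 ^ σ * L) ^ (-((α - σ) / σ))) ^ (1 / r), by positivity, ?_⟩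
  have hlim : Tendsto (fun M : ℕ => ⌈Real.logb 2 (L * M) / σ⌉₊) atTop atTop := by
    refine tendsto_nat_ceil_atTop.comp (Tendsto.atTop_div_const hσ ?_)
    exact (Real.tendsto_logb_atTop (by norm_num)).comp
      (tendsto_natCast_atTop_atTop.const_mul_atTop hL0)
  filter_upwards [hlim.eventually h, eventually_gt_atTop 0] with M hM hM0
  have hM1 : (1 : ℝ) ≤ M := by exact_mod_cast hM0
  have hL1 : 1 ≤ L := by
    have : (1 : ℝ) ≤ 3 ^ d := one_le_pow₀ (by norm_num)
    linarith
  set n := ⌈Real.logb 2 (L * M) / σ⌉₊ with hn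
  have hlog0 : 0 ≤ Real.logb 2 (L * M) / σ :=
    div_nonneg (Real.logb_nonneg (by norm_num) (one_le_mul_of_one_le_of_one_le hL1 hM1)) hσ.le
  have hLM : 0 < L * M := by positivity
  have hlow : L * M ≤ 2 ^ (σ * n) := by
    rw [← Real.logb_le_iff_le_rpow (by norm_num) hLM, mul_comm σ, ← div_le_iff₀ hσ]
    exact Nat.le_ceil _
  have hup : 2 ^ (σ * n) ≤ 2 ^ σ * L * M := by
    have hlt := Nat.ceil_lt_add_one hlog0
    rw [← hn, ← sub_lt_iff_lt_add, lt_div_iff₀ hσ] at hlt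
    have : (2 : ℝ) ^ ((n - 1) * σ) ≤ L * M :=
      (Real.le_logb_iff_rpow_le (by norm_num) hLM).1 hlt.le
    calc (2 : ℝ) ^ (σ * n) = 2 ^ σ * 2 ^ ((n - 1) * σ) := by
          rw [← Real.rpow_add (by norm_num)]; congr 1; ring
      _ ≤ 2 ^ σ * (L * M) := by gcongr
      _ = _ := by ring
  have hcard : 2 * 3 ^ d * M ≤ (bigCubes ν r α n).card := by
    have := hlow.trans hM
    rw [hL] at this
    exact_mod_cast this
  refine le_trans (ENNReal.ofReal_le_ofReal ?_) (le_quantError_of_card hr hcard)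
  have hexp : (M : ℝ) ^ (-((α - σ) / (σ * r))) = ((M : ℝ) ^ (-((α - σ) / σ))) ^ (1 / r) := by
    rw [← Real.rpow_mul (by positivity)]; congr 1; field_simp
  rw [hexp, ← Real.mul_rpow (by positivity) (by positivity)]
  refine Real.rpow_le_rpow (by positivity) ?_ (by positivity)
  have hneg : -((α - σ) / σ) ≤ 0 := by
    rw [neg_nonpos]; exact div_nonneg (sub_pos.2 hσα).le hσ.le
  calc 1 / 2 * (2 ^ σ * L) ^ (-((α - σ) / σ)) * (M : ℝ) ^ (-((α - σ) / σ))
      = 1 / 2 * (2 ^ σ * L * M) ^ (-((α - σ) / σ)) := by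
        rw [Real.mul_rpow (x := 2 ^ σ * L) (by positivity) (by positivity)]; ring
    _ ≤ 1 / 2 * (2 ^ (σ * n)) ^ (-((α - σ) / σ)) := by
        have := Real.rpow_le_rpow_of_nonpos (by positivity) hup hneg
        gcongr
    _ = 1 / 2 * 2 ^ (σ * n) * 2 ^ (-(α * n)) := by
        rw [← Real.rpow_mul (by norm_num), mul_assoc (1 / 2 : ℝ), ← Real.rpow_add (by norm_num)]
        congr 2; field_simp; ring
    _ ≤ 1 / 2 * (bigCubes ν r α n).card * 2 ^ (-(α * n)) := by gcongr

/-- Choose α nearly optimal and σ = sα; the resulting exponent σr/(α-σ) = rs/(1-s) no longer depends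
on α. -/
theorem le_lowerQuantDim_of_lt_lowerF (hν : IsCompact ν.support) (hd : 0 < d) (hr : 0 < r)
    {s : ℝ} (hs0 : 0 < s) (hs1 : s < 1) (hs : s < lowerF ν r) :
    ((r * s / (1 - s) : ℝ) : EReal) ≤ lowerQuantDim ν r := by
  obtain ⟨α, hα⟩ := lt_iSup_iff.1 hs
  obtain ⟨hα0, hα⟩ := lt_iSup_iff.1 hα
  rw [EReal.lt_div_iff (EReal.coe_pos.2 hα0) (EReal.coe_ne_top _), ← EReal.coe_mul] at hα
  have hsα : 0 < s * α := by positivity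
  obtain ⟨c, hc, hcM⟩ := eventually_le_quantError hr hsα (mul_lt_of_lt_one_left hα0 hs1)
    (eventually_le_card hν hd hr hsα.le hα)
  have := le_lowerQuantDim hc
    (div_pos (sub_pos.2 (mul_lt_of_lt_one_left hα0 hs1)) (by positivity))
    (eventually_quantError_lt_one hν hd hr) hcM
  have heq : 1 / ((α - s * α) / (s * α * r)) = r * s / (1 - s) := by
    have h1 : 1 - s ≠ 0 := (sub_pos.2 hs1).ne'
    rw [one_div_div, show α - s * α = α * (1 - s) by ring]
    field_simp
  rwa [heq] at this

theorem critExp_le_lowerQuantDim (hν : IsCompact ν.support) (hd : 0 < d) (hr : 0 < r)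
    (hreg : MFRegular ν r) :
    ((r * critExp ν r / (1 - critExp ν r) : ℝ) : EReal) ≤ lowerQuantDim ν r := by
  have hF : critExp ν r ≤ lowerF ν r := hreg.symm ▸ critExp_le_upperF hν hd hr
  have h1 := critExp_lt_one (r := r) hν hr
  set c := critExp ν r with hc
  rcases (critExp_nonneg (ν := ν) (r := r)).eq_or_lt with h0 | h0
  · rw [← hc] at h0
    rw [← h0]
    simpa using lowerQuantDim_nonneg (eventually_quantError_lt_one hν hd hr)
  have hlim : Tendsto (fun b : ℝ => ((r * b / (1 - b) : ℝ) : EReal)) (𝓝[<] c)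
      (𝓝 ((r * c / (1 - c) : ℝ) : EReal)) := by
    refine (continuous_coe_real_ereal.tendsto _).comp (Tendsto.mono_left ?_ nhdsWithin_le_nhds)
    have hne : 1 - c ≠ 0 := (sub_pos.2 h1).ne'
    have : ContinuousAt (fun b : ℝ => r * b / (1 - b)) c := by fun_prop (disch := exact hne)
    exact this
  refine le_of_tendsto hlim ?_
  filter_upwards [Ioo_mem_nhdsLT h0] with b hb
  exact le_lowerQuantDim_of_lt_lowerF hν hd hr hb.1 (hb.2.trans h1)
    (lt_of_lt_of_le (EReal.coe_lt_coe_iff.2 hb.2) hF)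

end

end QuantDim

end

/-! ### Conclusion: both bounds equal rc/(1-c). -/

theorem theorem1p8 (d : ℕ) (hd : 0 < d) (ν : Measure (EuclideanSpace ℝ (Fin d)))
    [IsProbabilityMeasure ν] (hν : IsCompact ν.support) (r : ℝ) (hr : 0 < r) :
    (QuantDim.LqRegular ν r → QuantDim.MFRegular ν r) ∧
    (QuantDim.MFRegular ν r →
      QuantDim.lowerQuantDim ν r = QuantDim.upperQuantDim ν r ∧
      (0 < QuantDim.critExp ν r →
        QuantDim.upperQuantDim ν r = QuantDim.renyiDim ν (QuantDim.critExp ν r)) ∧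
      (QuantDim.critExp ν r = 0 → QuantDim.upperQuantDim ν r = 0)) := by
  refine ⟨QuantDim.MFRegular_of_LqRegular hν hd hr, fun hreg => ?_⟩
  have hlow := QuantDim.critExp_le_lowerQuantDim hν hd hr hreg
  have hup := QuantDim.upperQuantDim_le_critExp (ν := ν) hν hd hr
  have hle := QuantDim.lowerQuantDim_le_upperQuantDim (ν := ν) (r := r)
  have heq := le_antisymm hup (hlow.trans hle)
  refine ⟨le_antisymm hle (hup.trans hlow), fun h0 => ?_, fun h0 => ?_⟩
  -- Since c < 1, the entropy branch of the Rényi dimension never occurs here.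
  · rw [heq, QuantDim.renyiDim, if_neg (QuantDim.critExp_lt_one hν hr).ne,
      QuantDim.beta_critExp hν hr h0, EReal.coe_div]
  · rw [heq, h0]; simp
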